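/- Let $q>0$ be real. Indices $a=(AA')$ run through $(11),(12),(21),(22)$, numbered $1,\dots,4$; $\bar a=(A'A)$; repeated indices are summed. Let $R$ be the standard $SU_q(2)$ R-matrix, with non-zero entries $R^{11}_{\;11}=R^{22}_{\;22}=q$, $R^{12}_{\;12}=R^{21}_{\;21}=1$, $R^{12}_{\;21}=q-q^{-1}$, let $\widetilde R=((R^{t_2})^{-1})^{t_2}$, and put $$\mathbf R_{M\,cd}^{\;ab}=R^{-1\,LC}_{\quad\;BI}R^{B'I}_{\;JA}R^{A'J}_{\;KD'}\widetilde R^{KD}_{\;C'L},\qquad \mathbf R_{L\,cd}^{\;ab}=R^{CI}_{\;JB}R^{B'J}_{\;KA}R^{A'K}_{\;LD'}\widetilde R^{LD}_{\;C'I}.$$ With $\varepsilon_{12}=q^{-1/2}$, $\varepsilon_{21}=-q^{1/2}$, $\varepsilon_{11}=\varepsilon_{22}=0$, $\varepsilon^{AB}=-\varepsilon_{BA}$, let $G^{ab}=\varepsilon_{AC}R^{A'C}_{\;DB}\varepsilon^{DB'}$, let $g^{ab}=G^{ab}/(q+q^{-1})$ be the q-metric, and let $g_{ab}$ be defined by $g^{ab}g_{cb}=\delta^a_c$.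 *Algebras.* q-Minkowski space $M_q$ is the unital $\mathbb C$-algebra generated by $x_a$ with $x_ax_b=x_dx_c\mathbf R_{M\,ab}^{\;cd}$. The q-light cone $P_0$ is the unital $\mathbb C$-algebra generated by $p^a$ with $p^ap^b=\mathbf R_{M\,cd}^{\;ab}p^dp^c$ and $g_{ab}p^ap^b=0$. Both carry antilinear antimultiplicative star structures, $\bar x_a=x_{\bar a}$ and $\overline{p^a}=p^{\bar a}$; on $M_q\otimes P_0$ the star acts factorwise. The quantum Lorentz group $\mathcal L_q$ is the algebra generated by $\lambda^a_{\;b}$ with $\mathbf R_{L\,ef}^{\;ab}\lambda^e_{\;c}\lambda^f_{\;d}=\lambda^b_{\;f}\lambda^a_{\;e}\mathbf R_{L\,cd}^{\;ef}$ and $\lambda^a_{\;c}\lambda^b_{\;d}g^{cd}=g^{ab}$; $\widetilde{\mathcal L}_q$ is $\mathcal L_q$ with an invertible central element $\varsigma$ adjoined. It coacts by algebra maps $x_a\mapsto x_b\otimes\lambda^b_{\;a}\varsigma$ on $M_q$ and $p^a\mapsto p^b\otimes S\lambda^a_{\;b}\,\varsigma^{-1}$ on $P_0$, where $S\lambda^a_{\;b}=g^{ac}\lambda^d_{\;c}g_{bd}$,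 and on $M_q\otimes P_0$ by the tensor product coaction. The braided derivatives $\partial^a:M_q\to M_q$ are the linear maps with $\partial^a1=0$ and $\partial^a(x_bf)=\delta^a_bf+x_c\mathbf R_{L\,bd}^{\;ca}\,\partial^df$ for all $f\in M_q$; $\partial_a=g_{ab}\partial^b$. Formal power series in $M_q\otimes P_0$ are formal sums over the degree in the $p^a$; the star, the coaction and $\partial^a$ (acting on the factor $M_q$) are applied termwise, and $p^a$ multiplies from the right. *Forms.* Let $\varepsilon_{abcd}$ be the tensor with $\varepsilon_{1234}=1$ which is totally q-antisymmetric, i.e. $\varepsilon_{abcd}=-\varepsilon_{ijcd}\mathbf R_{L\,ab}^{\;ji}=-\varepsilon_{aijd}\mathbf R_{L\,bc}^{\;ji}=-\varepsilon_{abij}\mathbf R_{L\,cd}^{\;ji}$, and let $\varepsilon^{abcd}=\varepsilon_{ijkl}G^{ia}G^{jb}G^{kc}G^{ld}$. Let $n_1=n_3=2(1+q^2+q^4)$, $n_2=(1+q^2)^2$, $n_0=n_4=2q^{-2}(1+q^2+q^4)(1+q^2)^2$. The q-antisymmetrisation of $k$ indices is $T_{[a_1\dots a_k]}=T_{c_1\dots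 c_k}\mathcal A^{c_1\dots c_k}_{\{k\}\,a_1\dots a_k}$, where $$\mathcal A^{abcd}_{\{4\}efgh}=\tfrac1{n_4}\varepsilon^{dcba}\varepsilon_{efgh},\quad \mathcal A^{abc}_{\{3\}fgh}=-\tfrac1{n_3}\varepsilon^{dcba}\varepsilon_{dfgh},\quad \mathcal A^{ab}_{\{2\}gh}=\tfrac1{n_2}\varepsilon^{dcba}\varepsilon_{cdgh},\quad \mathcal A^{a}_{\{1\}h}=-\tfrac1{n_1}\varepsilon^{dcba}\varepsilon_{bcdh},$$ $\mathcal A_{\{0\}}=1$ and $\mathcal A_{\{k\}}=0$ for $k\ge5$. On forms $\mathbf w$, given by their values on the basic elements $\mathbf e_{a_1\dots a_k}$ (on $\mathbf e$ for $k=0$), let $d\mathbf w(\mathbf e_{a_1\dots a_{k+1}})=\partial_{[a_1}w_{a_2\dots a_{k+1}]}$ and ${}^*\mathbf w(\mathbf e_{a_1\dots a_{4-k}})=n_k^{-1/2}\varepsilon_{a_1\dots a_{4-k}b_1\dots b_k}G^{b_1c_k}\cdots G^{b_kc_1}w_{[c_1\dots c_k]}$, and put $\delta={}^*d\,{}^*$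 and $\boldsymbol\Delta=\delta d+d\delta$. A complex valued solution of the q-d'Alembert equation with values in formal power series in $M_q\otimes P_0$ is a linear map $\boldsymbol\varphi$ on $\mathrm{span}_{\mathbb C}\{\mathbf e,\bar{\mathbf e}\}$ (whose elements are $\widetilde{\mathcal L}_q$-scalars, with star $\mathbf e\leftrightarrow\bar{\mathbf e}$) which is a $*$-map and an $\widetilde{\mathcal L}_q$-comodule morphism, such that for each $v$ in the span the 0-form with value $\boldsymbol\varphi(v)$ is annihilated by $\boldsymbol\Delta$. *q-exponentials.* For $t>0$ and $z\in\mathbb C$ let $$\exp_t(z\,x.p)=\sum_{n\ge0}\frac{z^n}{[n]_t!}\,x_{a_1}\cdots x_{a_n}\otimes p^{a_n}\cdots p^{a_1},\qquad [n]_t=1+t+\dots+t^{n-1},\quad [n]_t!=[1]_t\cdots[n]_t .$$ **Proposition.** The star structures of $M_q$ and $P_0$, the coactions on $M_q$ and $P_0$ and the derivatives $\partial^a$ above are well defined, and: 1. For every $t>0$ (in particular for $t=q$ and for $t=q^2$) the plane waves $\mathbf e\mapsto\exp_t(i\,x.p)$, $\bar{\mathbf e}\mapsto\exp_t(-i\,x.p)$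 are a complex valued solution of the q-d'Alembert equation. 2. For $t=q^2$, every $z\in\mathbb C$ and every $a$, $\ \partial^a\exp_{q^2}(z\,x.p)=\exp_{q^2}(z\,x.p)\,z\,p^a$; in particular $\partial^a\exp_{q^2}(i\,x.p)=\exp_{q^2}(i\,x.p)\,i\,p^a$. -/

import Mathlib

open scoped TensorProduct BigOperators ComplexConjugate

noncomputable section

namespace QMinkowski

/-! ### Index conventions

A Minkowski index `a = (A A')` runs through `(11), (12), (21), (22)`, coded as `0, 1, 2, 3 : Fin 4`.
Spinor indices `1, 2` are coded as `0, 1 : Fin 2`. -/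

/-- Minkowski (multi-)indices. -/
abbrev Idx := Fin 4

/-- The first spinor index `A` of `a = (A A')`. -/
def fstI : Idx → Fin 2 := ![0, 0, 1, 1]

/-- The second spinor index `A'` of `a = (A A')`. -/
def sndI : Idx → Fin 2 := ![0, 1, 0, 1]

/-- The twisted index `(A' A)` of `a = (A A')`. -/
def bar : Idx → Idx := ![0, 2, 1, 3]

/-! ### R-matrices and metric

A matrix `X` on `Fin 2 × Fin 2` stands for the tensor `X (A, B) (C, D)` with upper indices `A B` and
lower indices `C D`. -/

/-- The standard `SU_q(2)` R-matrix. -/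
def suR (q : ℝ) : Matrix (Fin 2 × Fin 2) (Fin 2 × Fin 2) ℝ := fun i j =>
  if i = j then (if i.1 = i.2 then q else 1)
  else if i = (0, 1) ∧ j = (1, 0) then q - q⁻¹ else 0

/-- Transposition in the second tensor factor. -/
def transposeSnd (X : Matrix (Fin 2 × Fin 2) (Fin 2 × Fin 2) ℝ) :
    Matrix (Fin 2 × Fin 2) (Fin 2 × Fin 2) ℝ := fun i j => X (i.1, j.2) (j.1, i.2)

/-- `((R^{t₂})⁻¹)^{t₂}`. -/
def suRTilde (q : ℝ) : Matrix (Fin 2 × Fin 2) (Fin 2 × Fin 2) ℝ :=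
  transposeSnd (transposeSnd (suR q))⁻¹

/-- The 4-dimensional R-matrix `R_M`; `RM q a b c d` has upper indices `a b`, lower indices `c d`. -/
def RM (q : ℝ) (a b c d : Idx) : ℝ :=
  ∑ i : Fin 2, ∑ j : Fin 2, ∑ k : Fin 2, ∑ l : Fin 2,
    (suR q)⁻¹ (l, fstI c) (fstI b, i) * suR q (sndI b, i) (j, fstI a) *
      suR q (sndI a, j) (k, sndI d) * suRTilde q (k, fstI d) (sndI c, l)

/-- The 4-dimensional R-matrix `R_L`; `RL q a b c d` has upper indices `a b`, lower indices `c d`. -/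
def RL (q : ℝ) (a b c d : Idx) : ℝ :=
  ∑ i : Fin 2, ∑ j : Fin 2, ∑ k : Fin 2, ∑ l : Fin 2,
    suR q (fstI c, i) (j, fstI b) * suR q (sndI b, j) (k, fstI a) *
      suR q (sndI a, k) (l, sndI d) * suRTilde q (l, fstI d) (sndI c, i)

/-- The spinor metric `ε_{AB}`. -/
def spinorMetric (q : ℝ) : Matrix (Fin 2) (Fin 2) ℝ := !![0, 1 / √q; -√q, 0]

/-- The spinor metric with upper indices, `ε^{AB} = -ε_{BA}`. -/
def spinorMetricUp (q : ℝ) : Matrix (Fin 2) (Fin 2) ℝ := fun A B => -spinorMetric q B A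

/-- `ε_{AC} R^{A'C}_{DB} ε^{DB'}`, which is `q + q⁻¹` times the q-metric. -/
def rawMetric (q : ℝ) : Matrix Idx Idx ℝ := fun a b =>
  ∑ C : Fin 2, ∑ D : Fin 2,
    spinorMetric q (fstI a) C * suR q (sndI a, C) (D, fstI b) * spinorMetricUp q D (sndI b)

/-- The q-metric `g^{ab}`. -/
def metricUp (q : ℝ) : Matrix Idx Idx ℝ := fun a b => (q + q⁻¹)⁻¹ * rawMetric q a b

/-- The inverse q-metric `g_{ab}`, normalised by `∑_b g^{ab} g_{cb} = δ^a_c`.  (Indices are raised by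
`T^a = ∑_i T_i g^{ia}` and lowered by `T_a = ∑_b g_{ab} T^b`.) -/
def metricDown (q : ℝ) : Matrix Idx Idx ℝ := ((metricUp q)⁻¹).transpose

/-! ### The algebras -/

/-- The relations `x_a x_b = x_d x_c R_M^{cd}_{ab}`. -/
inductive RelM (q : ℝ) : FreeAlgebra ℂ Idx → FreeAlgebra ℂ Idx → Prop
  | comm (a b : Idx) : RelM q (FreeAlgebra.ι ℂ a * FreeAlgebra.ι ℂ b)
      (∑ c : Idx, ∑ d : Idx, (RM q c d a b : ℂ) • (FreeAlgebra.ι ℂ d * FreeAlgebra.ι ℂ c))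

/-- q-Minkowski space: the algebra of quantum covectors `V'(R_M)`. -/
abbrev Mq (q : ℝ) := RingQuot (RelM q)

/-- The relations `p^a p^b = R_M^{ab}_{cd} p^d p^c` of the algebra of quantum vectors `V(R_M)`,
together with the light cone relation `g_{ab} p^a p^b = 0`. -/
inductive RelP (q : ℝ) : FreeAlgebra ℂ Idx → FreeAlgebra ℂ Idx → Prop
  | comm (a b : Idx) : RelP q (FreeAlgebra.ι ℂ a * FreeAlgebra.ι ℂ b)
      (∑ c : Idx, ∑ d : Idx, (RM q a b c d : ℂ) • (FreeAlgebra.ι ℂ d * FreeAlgebra.ι ℂ c))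
  | cone : RelP q
      (∑ a : Idx, ∑ b : Idx, (metricDown q a b : ℂ) • (FreeAlgebra.ι ℂ a * FreeAlgebra.ι ℂ b)) 0

/-- The q-light cone `P₀`. -/
abbrev P0 (q : ℝ) := RingQuot (RelP q)

/-- The quotient map from the free algebra onto `M_q`. -/
def mkM (q : ℝ) : FreeAlgebra ℂ Idx →ₐ[ℂ] Mq q := RingQuot.mkAlgHom ℂ (RelM q)

/-- The quotient map from the free algebra onto `P₀`. -/
def mkP (q : ℝ) : FreeAlgebra ℂ Idx →ₐ[ℂ] P0 q := RingQuot.mkAlgHom ℂ (RelP q)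

/-- The coordinates `x_a`. -/
def x (q : ℝ) (a : Idx) : Mq q := mkM q (FreeAlgebra.ι ℂ a)

/-- The momenta `p^a`. -/
def p (q : ℝ) (a : Idx) : P0 q := mkP q (FreeAlgebra.ι ℂ a)

/-- The generator `λ^a_b` in the free algebra. -/
def preLam (a b : Idx) : FreeAlgebra ℂ (Idx × Idx) := FreeAlgebra.ι ℂ (a, b)

/-- The relations of the quantum Lorentz group: those of the FRT algebra `A(R_L)` and the metric
relation `λ^a_c λ^b_d g^{cd} = g^{ab}`. -/
inductive RelL (q : ℝ) : FreeAlgebra ℂ (Idx × Idx) → FreeAlgebra ℂ (Idx × Idx) → Prop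
  | frt (a b c d : Idx) : RelL q
      (∑ e : Idx, ∑ f : Idx, (RL q a b e f : ℂ) • (preLam e c * preLam f d))
      (∑ e : Idx, ∑ f : Idx, (RL q e f c d : ℂ) • (preLam b f * preLam a e))
  | metric (a b : Idx) : RelL q
      (∑ c : Idx, ∑ d : Idx, (metricUp q c d : ℂ) • (preLam a c * preLam b d))
      (algebraMap ℂ _ (metricUp q a b : ℂ))

/-- The quantum Lorentz group `L_q` (its algebra). -/
abbrev Lq (q : ℝ) := RingQuot (RelL q)

/-- The generators `λ^a_b` of `L_q`. -/
def lam (q : ℝ) (a b : Idx) : Lq q := RingQuot.mkAlgHom ℂ (RelL q) (preLam a b)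

/-- The antipode on generators, `S λ^a_b = g^{ac} λ^d_c g_{bd}`. -/
def antipodeLam (q : ℝ) (a b : Idx) : Lq q :=
  ∑ c : Idx, ∑ d : Idx, ((metricUp q a c * metricDown q b d : ℝ) : ℂ) • lam q d c

/-- The extended quantum Lorentz group: `L_q` with an invertible central element `ς` adjoined. The
dilaton `ς` is the variable `LaurentPolynomial.T 1`. -/
abbrev LqExt (q : ℝ) := LaurentPolynomial (Lq q)

/-! ### Structure maps

Each structure map is given on the free algebra and then passed to the quotient. -/

/-- The map `ψ` with `ψ ∘ π = φ` for a surjection `π`, if there is one (and `0` otherwise). -/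
def descend {A B C : Type*} [AddCommMonoid A] [AddCommMonoid B] [AddCommMonoid C]
    [Module ℂ A] [Module ℂ B] [Module ℂ C] {σ : ℂ →+* ℂ}
    (π : A →ₗ[ℂ] B) (φ : A →ₛₗ[σ] C) : B →ₛₗ[σ] C :=
  open Classical in
  if h : ∃ ψ : B →ₛₗ[σ] C, ∀ w, ψ (π w) = φ w then h.choose else 0

/-- `∂^a` on a word, by the braided Leibniz rule:
`∂^a 1 = 0` and `∂^a (x_b f) = δ^a_b f + x_c R_L^{ca}_{bd} ∂^d f`. -/
def wordPartial (q : ℝ) : List Idx → Idx → Mq q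
  | [], _ => 0
  | b :: w, a => (if a = b then (w.map (x q)).prod else 0) +
      ∑ c : Idx, ∑ d : Idx, (RL q c a b d : ℂ) • (x q c * wordPartial q w d)

/-- `∂^a` on the free algebra. -/
def freePartial (q : ℝ) (a : Idx) : FreeAlgebra ℂ Idx →ₗ[ℂ] Mq q :=
  (FreeAlgebra.basisFreeMonoid ℂ Idx).constr ℂ fun w => wordPartial q w.toList a

/-- The braided partial derivative `∂^a` on `M_q`. -/
def partialM (q : ℝ) (a : Idx) : Mq q →ₗ[ℂ] Mq q := descend (mkM q).toLinearMap (freePartial q a)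

/-- The antilinear antimultiplicative map on the free algebra which sends the generator with index
`a` to the one with index `bar a`. -/
def freeConj : FreeAlgebra ℂ Idx →ₛₗ[starRingEnd ℂ] FreeAlgebra ℂ Idx where
  toFun f := ((FreeAlgebra.basisFreeMonoid ℂ Idx).repr f).sum fun w c =>
    conj c • ((w.toList.map fun a => FreeAlgebra.ι ℂ (bar a)).reverse.prod : FreeAlgebra ℂ Idx)
  map_add' f g := by
    rw [map_add]
    exact Finsupp.sum_add_index' (by simp) (by intro w a b; rw [map_add, add_smul])
  map_smul' c f := by
    rw [map_smul, Finsupp.sum_smul_index' (by simp), Finsupp.smul_sum]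
    simp [mul_smul]

/-- The star structure of `M_q`, with `star x_a = x_{bar a}`. -/
def conjM (q : ℝ) : Mq q →ₛₗ[starRingEnd ℂ] Mq q :=
  descend (mkM q).toLinearMap ((mkM q).toLinearMap.comp freeConj)

/-- The star structure of `P₀`, with `star p^a = p^{bar a}`. -/
def conjP (q : ℝ) : P0 q →ₛₗ[starRingEnd ℂ] P0 q :=
  descend (mkP q).toLinearMap ((mkP q).toLinearMap.comp freeConj)

/-- The algebra map `x_a ↦ x_b ⊗ λ^b_a ς` on the free algebra. -/
def freeCoactM (q : ℝ) : FreeAlgebra ℂ Idx →ₐ[ℂ] Mq q ⊗[ℂ] LqExt q :=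
  FreeAlgebra.lift ℂ fun a =>
    ∑ b : Idx, x q b ⊗ₜ[ℂ] (LaurentPolynomial.C (lam q b a) * LaurentPolynomial.T 1)

/-- The algebra map `p^a ↦ p^b ⊗ S λ^a_b ς⁻¹` on the free algebra. -/
def freeCoactP (q : ℝ) : FreeAlgebra ℂ Idx →ₐ[ℂ] P0 q ⊗[ℂ] LqExt q :=
  FreeAlgebra.lift ℂ fun a =>
    ∑ b : Idx, p q b ⊗ₜ[ℂ] (LaurentPolynomial.C (antipodeLam q a b) * LaurentPolynomial.T (-1))

/-- The coaction of the extended quantum Lorentz group on `M_q`. -/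
def coactM (q : ℝ) : Mq q →ₗ[ℂ] Mq q ⊗[ℂ] LqExt q :=
  descend (mkM q).toLinearMap (freeCoactM q).toLinearMap

/-- The coaction of the extended quantum Lorentz group on `P₀`. -/
def coactP (q : ℝ) : P0 q →ₗ[ℂ] P0 q ⊗[ℂ] LqExt q :=
  descend (mkP q).toLinearMap (freeCoactP q).toLinearMap

/-- The structure maps are well defined on the quotients: each of them composed with the quotient map
is the map given on the free algebra. -/
structure WellDefined (q : ℝ) : Prop where
  partialM_mk : ∀ a w, partialM q a (mkM q w) = freePartial q a w
  conjM_mk : ∀ w, conjM q (mkM q w) = mkM q (freeConj w)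
  conjP_mk : ∀ w, conjP q (mkP q w) = mkP q (freeConj w)
  coactM_mk : ∀ w, coactM q (mkM q w) = freeCoactM q w
  coactP_mk : ∀ w, coactP q (mkP q w) = freeCoactP q w

/-! ### Formal power series in `M_q ⊗ P₀` -/

/-- Formal power series in `M_q ⊗ P₀`: the sequence `S` stands for `∑ₙ S n`, where `S n` is the
component of degree `n` in the momenta. -/
abbrev Series (q : ℝ) := ℕ → Mq q ⊗[ℂ] P0 q

/-- `∂^a` acts on the coordinates. -/
def partialUp (q : ℝ) (a : Idx) (S : Series q) : Series q := fun n =>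
  (partialM q a).rTensor (P0 q) (S n)

/-- `∂_a = g_{ab} ∂^b`. -/
def partialDown (q : ℝ) (a : Idx) (S : Series q) : Series q :=
  ∑ b : Idx, (metricDown q a b : ℂ) • partialUp q b S

/-- Right multiplication of a series by the momentum `p^a`, which raises the degree by one. -/
def mulMomentum (q : ℝ) (S : Series q) (a : Idx) : Series q
  | 0 => 0
  | n + 1 => (LinearMap.mulRight ℂ (p q a)).lTensor (Mq q) (S n)

/-- The star operation on series. -/
def conjSeries (q : ℝ) (S : Series q) : Series q := fun n =>
  TensorProduct.map (conjM q) (conjP q) (S n)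

/-- The tensor product coaction on `M_q ⊗ P₀`:
`m ⊗ f ↦ m₍₀₎ ⊗ f₍₀₎ ⊗ m₍₁₎ f₍₁₎`. -/
def coactMP (q : ℝ) : Mq q ⊗[ℂ] P0 q →ₗ[ℂ] (Mq q ⊗[ℂ] P0 q) ⊗[ℂ] LqExt q :=
  (LinearMap.mul' ℂ (LqExt q)).lTensor (Mq q ⊗[ℂ] P0 q) ∘ₗ
    (TensorProduct.tensorTensorTensorComm ℂ (Mq q) (LqExt q) (P0 q) (LqExt q)).toLinearMap ∘ₗ
      TensorProduct.map (coactM q) (coactP q)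

/-! ### Differential forms

A form is given by its values `w(e_{a₁ … aₚ})` on the basic elements of each valence `p`. -/

/-- Inhomogeneous forms with values in the formal power series. -/
abbrev Form (q : ℝ) := (n : ℕ) → (Fin n → Idx) → Series q

/-- The non-zero entries `ε_{abcd}` of the totally q-antisymmetric tensor, with `a, b, c, d` counted
from 1 to 4 and written as the decimal digits of the key. -/
def epsTable (q : ℝ) : List (ℕ × ℝ) :=
  [(1234, 1), (1243, -q⁻¹ ^ 2), (1324, -1), (1342, q ^ 2),
   (1414, 1 - q ^ 2), (1423, 1), (1432, -1), (1444, 1 - q⁻¹ ^ 2),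
   (2134, -1), (2143, q⁻¹ ^ 2), (2314, 1), (2341, -1),
   (2413, -q⁻¹ ^ 2), (2431, q⁻¹ ^ 2), (2434, q⁻¹ ^ 2 - 1), (3124, 1),
   (3142, -q ^ 2), (3214, -1), (3241, 1), (3412, q ^ 2),
   (3421, -q ^ 2), (3424, 1 - q ^ 2), (4123, -1), (4132, 1),
   (4141, q ^ 2 - 1), (4144, q⁻¹ ^ 2 - 1), (4213, 1), (4231, -1),
   (4243, 1 - q⁻¹ ^ 2), (4312, -1), (4321, 1), (4342, q ^ 2 - 1),
   (4414, 1 - q⁻¹ ^ 2), (4441, q⁻¹ ^ 2 - 1)]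

/-- The totally q-antisymmetric tensor `ε_{abcd}`. -/
def epsDown (q : ℝ) : List Idx → ℝ
  | [a, b, c, d] => ((epsTable q).map fun e =>
      if e.1 = 1000 * (a.val + 1) + 100 * (b.val + 1) + 10 * (c.val + 1) + (d.val + 1)
      then e.2 else 0).sum
  | _ => 0

/-- The tensor `ε^{abcd} = ε_{ijkl} G^{ia} G^{jb} G^{kc} G^{ld}`, where `G` is the metric normalised
so that the antisymmetrisers below are projectors. -/
def epsUp (q : ℝ) : List Idx → ℝ
  | [a, b, c, d] => ∑ i : Idx, ∑ j : Idx, ∑ k : Idx, ∑ l : Idx,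
      epsDown q [i, j, k, l] *
        (rawMetric q i a * rawMetric q j b * rawMetric q k c * rawMetric q l d)
  | _ => 0

/-- The normalisation factors `n_k`, `0 ≤ k ≤ 4`. -/
def normFactor (q : ℝ) : ℕ → ℝ
  | 1 => 2 * (1 + q ^ 2 + q ^ 4)
  | 2 => (1 + q ^ 2) * (1 + q ^ 2)
  | 3 => 2 * (1 + q ^ 2 + q ^ 4)
  | _ => q⁻¹ ^ 2 * 2 * (1 + q ^ 2 + q ^ 4) * (1 + q ^ 2) * (1 + q ^ 2)

/-- The q-antisymmetriser with upper indices `u` and lower indices `v`: it is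
`(-1)^k n_k⁻¹ ∑_s ε^{reverse (u s)} ε_{s v}` for `1 ≤ k ≤ 4`, trivial for `k = 0` and zero for
`k ≥ 5`. -/
def antisym (q : ℝ) (k : ℕ) (u v : Fin k → Idx) : ℝ :=
  if k = 0 then 1
  else if k < 5 then
    (-1) ^ k / normFactor q k * ∑ s : Fin (4 - k) → Idx,
      epsUp q (List.ofFn u ++ List.ofFn s).reverse * epsDown q (List.ofFn s ++ List.ofFn v)
  else 0

/-- The q-exterior derivative `dw(e_{a₁ … aₚ₊₁}) = ∂_{[a₁} w_{a₂ … aₚ₊₁]}`. -/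
def extDeriv (q : ℝ) (w : Form q) : Form q
  | 0, _ => 0
  | k + 1, a => ∑ b : Fin (k + 1) → Idx,
      (antisym q (k + 1) b a : ℂ) • partialDown q (b 0) (w k (Fin.tail b))

/-- The q-Hodge star: for a form of valence `k = 4 - r`,
`⋆w(e_{a₁ … a_r}) = n_k^{-1/2} ε_{a₁ … a_r b₁ … b_k} G^{b₁ c_k} … G^{b_k c₁} w_{[c₁ … c_k]}`. -/
def hodge (q : ℝ) (w : Form q) : Form q := fun r a =>
  if r ≤ 4 then
    ∑ b : Fin (4 - r) → Idx, ∑ c : Fin (4 - r) → Idx, ∑ u : Fin (4 - r) → Idx,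
      (((√(normFactor q (4 - r)))⁻¹ * epsDown q (List.ofFn a ++ List.ofFn b) *
        (∏ i, rawMetric q (b i) (c (Fin.rev i))) * antisym q (4 - r) u c : ℝ) : ℂ) • w (4 - r) u
  else 0

/-- The q-coderivative `δ = ⋆ d ⋆`. -/
def coderiv (q : ℝ) (w : Form q) : Form q := hodge q (extDeriv q (hodge q w))

/-- The q-Laplace-Beltrami operator `Δ = δ d + d δ`. -/
def laplaceBeltrami (q : ℝ) (w : Form q) : Form q :=
  coderiv q (extDeriv q w) + extDeriv q (coderiv q w)

/-- The 0-form with value `S` on `e`. -/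
def zeroForm (q : ℝ) (S : Series q) : Form q
  | 0, _ => S
  | _ + 1, _ => 0

/-! ### Complex valued solutions and plane waves -/

/-- The star on `span {e, ē}`, where `e = (1, 0)` and `ē = (0, 1)`. -/
def conjPair (v : ℂ × ℂ) : ℂ × ℂ := (conj v.2, conj v.1)

/-- A complex valued solution of the q-d'Alembert equation, indexed by the q-light cone: a linear
`*`-map `φ` from `span {e, ē}` (whose elements are scalars under the quantum Lorentz group) to the
formal power series, which is a comodule morphism and satisfies `Δ φ = 0`. -/
structure IsComplexSolution (q : ℝ) (φ : ℂ × ℂ →ₗ[ℂ] Series q) : Prop where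
  star_map : ∀ v, φ (conjPair v) = conjSeries q (φ v)
  covariant : ∀ v n, coactMP q (φ v n) = φ v n ⊗ₜ[ℂ] (1 : LqExt q)
  dalembert : ∀ v, laplaceBeltrami q (zeroForm q (φ v)) = 0

/-- The factorial `[n]! = [1] ⋯ [n]` of the q-integers `[n] = 1 + t + ⋯ + t^{n-1}`. -/
def qFactorial (t : ℝ) (n : ℕ) : ℝ :=
  ∏ m ∈ Finset.range n, ∑ k ∈ Finset.range (m + 1), t ^ k

/-- The q-exponential `exp(z x.p) = ∑ₙ zⁿ/[n]! x_{a₁} ⋯ x_{aₙ} ⊗ p^{aₙ} ⋯ p^{a₁}`, with q-integers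
in base `t`. -/
def qExp (q t : ℝ) (z : ℂ) : Series q := fun n =>
  (z ^ n / (qFactorial t n : ℂ)) • ∑ a : Fin n → Idx,
    (List.ofFn fun i => x q (a i)).prod ⊗ₜ[ℂ] (List.ofFn fun i => p q (a i)).reverse.prod

/-- The plane wave `e ↦ exp(i x.p)`, `ē ↦ exp(-i x.p)`. -/
def planeWave (q t : ℝ) : ℂ × ℂ →ₗ[ℂ] Series q :=
  (LinearMap.fst ℂ ℂ ℂ).smulRight (qExp q t Complex.I) +
    (LinearMap.snd ℂ ℂ ℂ).smulRight (qExp q t (-Complex.I))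

end QMinkowski

end

/-! Write B for `braid q` and M for `relMat q`, the matrices R_L and R_M composed with the flip and
acting on pairs of indices. Products of coordinates form a row vector killed by 1 - M, reversed
products of momenta a column vector killed by 1 - M. Everything rests on a few identities: (i) (1 +
B)(1 - M) = 0; (ii) B₁₂ B₂₃ M₁₂ = M₂₃ B₁₂ B₂₃; (iii) (B - q²)(q²B - 1) = (1 - M)(q²M + 1 + q² + q⁴);
(iv) q²(B - q²)(B + 1) has rank one and factors through contraction with g_{ab}; (v) M⁻¹ is M with
its indices barred and swapped, and the metric exchanges the coordinate and the momentum relations.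
After clearing denominators these are identities between integer polynomials in q², and the kernel
decides them on tables.

Identities (iii) and (iv) say that on the light cone B multiplies a product of two momenta by q²
(`IsMomentum.braid_mul`). In the derivative of x_{a₁}⋯x_{aₙ} ⊗ p^{aₙ}⋯p^{a₁} each coordinate that
∂^a crosses therefore costs exactly q², and the terms add up to the q-integer in base q²
(`partialM_pairing_succ`). This is the eigenvalue equation for t = q². Differentiating twice
produces g_{ab} p^a p^b = 0 in every degree separately, so the coefficients of the series play no
role and every base t gives a solution (`partialUp_partialUp`). For functions, the Laplace-Beltrami
operator vanishes as soon as g_{ab}∂^a∂^b does (`laplaceBeltrami_zeroForm`).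

The derivatives are well defined by (i) and (ii) (`isCoordinate_leibniz`), the star structures by
(v), and the coactions because (i) and (iii) express the relations through B, which commutes with
the Lorentz generators (`IsCoordinate.transform`). Each homogeneous component is real and invariant
because its index pairs are nested: they can be peeled off from the inside or from the outside
(`pairing_succ'`, `coactMP_pairing`). -/

namespace QMinkowski

/-! ### Polynomial tensors as tables

Polynomials in one variable with integer coefficients are given by their coefficient lists, so that
identities between tensors with polynomial entries are decided by evaluation. -/

/-- Integer polynomials, as lists of coefficients in increasing degree. -/
abbrev IntPoly := List ℤ

namespace IntPoly

/-- The value of a polynomial at a real number. -/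
def ev (u : ℝ) : IntPoly → ℝ
  | [] => 0
  | a :: l => a + u * ev u l

/-- Addition of polynomials. -/
def add : IntPoly → IntPoly → IntPoly
  | [], m => m
  | a :: l, [] => a :: l
  | a :: l, b :: m => (a + b) :: add l m

/-- Scalar multiplication of polynomials. -/
def smul (c : ℤ) : IntPoly → IntPoly
  | [] => []
  | a :: l => (c * a) :: smul c l

/-- Multiplication of polynomials. -/
def mul : IntPoly → IntPoly → IntPoly
  | [], _ => []
  | _ :: _, [] => []
  | a :: l, b :: m => add (smul a (b :: m)) (0 :: mul l (b :: m))

/-- Whether all coefficients vanish. -/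
def isZero : IntPoly → Bool
  | [] => true
  | a :: l => decide (a = 0) && isZero l

/-- Whether two coefficient lists represent the same polynomial. -/
def same (l m : IntPoly) : Bool := isZero (add l (smul (-1) m))

/-- The polynomial in the square of the variable. -/
def expand : IntPoly → IntPoly
  | [] => []
  | a :: l => a :: 0 :: expand l

/-- The sum over the spinor indices. -/
def sum2 (f : Fin 2 → IntPoly) : IntPoly := add (f 0) (f 1)

/-- The sum over the Minkowski indices. -/
def sum4 (f : Fin 4 → IntPoly) : IntPoly := add (f 0) (add (f 1) (add (f 2) (f 3)))

variable (u : ℝ)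

theorem ev_add (l m : IntPoly) : ev u (add l m) = ev u l + ev u m := by
  induction l generalizing m with
  | nil => simp [add, ev]
  | cons a l ih =>
    cases m with
    | nil => simp [add, ev]
    | cons b m => simp only [add, ev, ih, Int.cast_add]; ring

theorem ev_smul (c : ℤ) (l : IntPoly) : ev u (smul c l) = c * ev u l := by
  induction l with
  | nil => simp [smul, ev]
  | cons a l ih => simp only [smul, ev, ih, Int.cast_mul]; ring

theorem ev_mul (l m : IntPoly) : ev u (mul l m) = ev u l * ev u m := by
  induction l with
  | nil => simp [mul, ev]
  | cons a l ih =>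
    cases m with
    | nil => simp [mul, ev]
    | cons b m => simp only [mul, ev_add, ev_smul, ev, ih, Int.cast_zero]; ring

theorem ev_of_isZero {l : IntPoly} (h : isZero l = true) : ev u l = 0 := by
  induction l with
  | nil => rfl
  | cons a l ih =>
    simp only [isZero, Bool.and_eq_true, decide_eq_true_eq] at h
    simp [ev, h.1, ih h.2]

theorem ev_of_same {l m : IntPoly} (h : same l m = true) : ev u l = ev u m := by
  have := ev_of_isZero u h
  rw [ev_add, ev_smul] at this
  push_cast at this
  linarith

theorem ev_expand (l : IntPoly) : ev u (expand l) = ev (u ^ 2) l := by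
  induction l with
  | nil => rfl
  | cons a l ih => simp only [expand, ev, ih, Int.cast_zero]; ring

theorem ev_sum2 (f : Fin 2 → IntPoly) : ev u (sum2 f) = ∑ i, ev u (f i) := by
  simp [sum2, ev_add]

theorem ev_sum4 (f : Fin 4 → IntPoly) : ev u (sum4 f) = ∑ i, ev u (f i) := by
  simp only [sum4, ev_add, Fin.sum_univ_four]; ring

end IntPoly

/-- A conjunction over the Minkowski indices. -/
def all4 (f : Fin 4 → Bool) : Bool := f 0 && (f 1 && (f 2 && f 3))

theorem forall_of_all4 {f : Fin 4 → Bool} (h : all4 f = true) (i : Fin 4) : f i = true := by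
  simp only [all4, Bool.and_eq_true] at h
  fin_cases i
  exacts [h.1, h.2.1, h.2.2.1, h.2.2.2]

/-- Quadruples, as rows of tables. -/
abbrev Quad (α : Type) := α × α × α × α

/-- The entries of a quadruple. -/
def Quad.get {α : Type} (t : Quad α) (i : Fin 4) : α :=
  match i.val with
  | 0 => t.1
  | 1 => t.2.1
  | 2 => t.2.2.1
  | _ + 3 => t.2.2.2

/-! ### The two braidings as tables, and the braid relation between them -/

open IntPoly

/-- The entries of the braiding defined by `R_L`, times `q ^ 4`, as polynomials in `q ^ 2`. -/
def braidTable : Quad (Quad (Quad (Quad IntPoly))) :=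
  (((([0,0,0,1], [], [], [0,1,-2,1]), ([], [], [-1,3,-2], []), ([], [0,-1,1], [], []), ([0,1,-2,1], [], [], [-1,2,-1])),
    (([], [], [], []), ([0,0,0,1], [], [], [0,1,-2,1]), ([], [], [], []), ([], [0,0,-1,1], [], [])),
    (([], [], [0,0,-1,1], []), ([], [], [], []), ([0,0,1], [], [], []), ([], [], [0,1,-1], [])),
    (([], [], [], []), ([], [], [0,-1,1], []), ([], [], [], []), ([0,0,1], [], [], []))),
   ((([], [0,0,1], [], []), ([0,0,-1,1], [], [], [0,1,-1]), ([], [], [], []), ([], [], [], [])),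
    (([], [], [], []), ([], [0,0,0,1], [], []), ([], [], [], []), ([], [], [], [])),
    (([], [], [], [0,0,-1,1]), ([], [], [0,1,-2,1], []), ([], [0,0,1], [], []), ([0,0,-1,1], [], [], [0,1,-1])),
    (([], [], [], []), ([], [], [], [0,0,-1,1]), ([], [], [], []), ([], [0,0,0,1], [], []))),
   ((([], [], [0,0,0,1], []), ([], [], [], []), ([], [], [], [0,0,-1,1]), ([], [], [0,1,-2,1], [])),
    (([], [], [], []), ([], [], [0,0,1], []), ([], [], [], []), ([], [], [], [0,0,-1,1])),
    (([], [], [], []), ([], [], [], []), ([], [], [0,0,0,1], []), ([], [], [], [])),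
    (([], [], [], []), ([], [], [], []), ([], [], [], []), ([], [], [0,0,1], []))),
   ((([], [], [], [0,0,1]), ([], [], [0,-1,1], []), ([], [], [], []), ([], [], [], [])),
    (([], [], [], []), ([], [], [], [0,0,1]), ([], [], [], []), ([], [], [], [])),
    (([], [], [], []), ([], [], [], []), ([], [], [], [0,0,0,1]), ([], [], [0,0,-1,1], [])),
    (([], [], [], []), ([], [], [], []), ([], [], [], []), ([], [], [], [0,0,0,1]))))

/-- The entries of the braiding defined by `R_M`, times `q ^ 4`, as polynomials in `q ^ 2`. -/
def relTable : Quad (Quad (Quad (Quad IntPoly))) :=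
  (((([0,0,1], [], [], []), ([], [], [0,1,-1], []), ([], [0,-1,1], [], []), ([0,1,-2,1], [], [], [-1,2,-1])),
    (([], [], [], []), ([0,0,1], [], [], []), ([], [], [], []), ([], [0,0,-1,1], [], [])),
    (([], [], [], []), ([], [], [], []), ([0,0,1], [], [], []), ([], [], [0,1,-1], [])),
    (([], [], [], []), ([], [], [], []), ([], [], [], []), ([0,0,1], [], [], []))),
   ((([], [0,1], [], []), ([0,-1,1], [], [], [1,-1]), ([], [], [], []), ([], [], [], [])),
    (([], [], [], []), ([], [0,0,1], [], []), ([], [], [], []), ([], [], [], [])),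
    (([], [], [], []), ([], [], [], []), ([], [0,0,1], [], []), ([0,0,-1,1], [], [], [0,1,-1])),
    (([], [], [], []), ([], [], [], []), ([], [], [], []), ([], [0,0,0,1], [], []))),
   ((([], [], [0,0,0,1], []), ([], [], [], []), ([0,0,1,-1], [], [], [0,-1,1]), ([], [], [1,-1,-1,1], [])),
    (([], [], [], []), ([], [], [0,0,1], []), ([], [], [], []), ([0,0,1,-1], [], [], [0,-1,1])),
    (([], [], [], []), ([], [], [], []), ([], [], [0,0,1], []), ([], [], [], [])),
    (([], [], [], []), ([], [], [], []), ([], [], [], []), ([], [], [0,1], []))),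
   ((([], [], [], [0,0,1]), ([], [], [0,-1,1], []), ([], [0,1,-1], [], []), ([0,-1,2,-1], [], [], [1,-2,1])),
    (([], [], [], []), ([], [], [], [0,0,1]), ([], [], [], []), ([], [0,0,1,-1], [], [])),
    (([], [], [], []), ([], [], [], []), ([], [], [], [0,0,1]), ([], [], [0,-1,1], [])),
    (([], [], [], []), ([], [], [], []), ([], [], [], []), ([], [], [], [0,0,1]))))

/-- The braiding defined by `R_L`, with polynomial entries. -/
def braidPoly (a c b e : Fin 4) : IntPoly := (((braidTable.get a).get c).get b).get e

/-- The braiding defined by `R_M`, with polynomial entries. -/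
def relPoly (a c b e : Fin 4) : IntPoly := (((relTable.get a).get c).get b).get e

/-- This is B₁₂ B₂₃ M₁₂ = M₂₃ B₁₂ B₂₃, entry by entry. Both sides are cubic in the tables, so the
factors q⁴ carried by the tables cancel. -/
theorem mixed_check :
    (all4 fun a => all4 fun c => all4 fun c' => all4 fun b => all4 fun d => all4 fun d' =>
      same
        (sum4 fun m => sum4 fun n => mul (braidPoly a c m n)
          (sum4 fun k => mul (braidPoly n c' k d') (relPoly m k b d)))
        (sum4 fun m => sum4 fun n => mul (relPoly c c' m n)
          (sum4 fun k => mul (braidPoly a m b k) (braidPoly k n d d')))) = true := by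
  decide +kernel

end QMinkowski

/-! ### Comparison of the tables with the R-matrices, the metric and the antisymmetric tensor -/

namespace QMinkowski
open IntPoly

/-! ### Tensors with four indices -/

/-- Tensors with polynomial entries, two upper and two lower indices. -/
abbrev PolyTensor := Fin 4 → Fin 4 → Fin 4 → Fin 4 → IntPoly

namespace PolyTensor

/-- The product of tensors, as operators. -/
def mul (X Y : PolyTensor) : PolyTensor := fun a c b e =>
  sum4 fun m => sum4 fun n => IntPoly.mul (X a c m n) (Y m n b e)

/-- The sum of tensors. -/
def add (X Y : PolyTensor) : PolyTensor := fun a c b e => IntPoly.add (X a c b e) (Y a c b e)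

/-- A polynomial multiple of the identity. -/
def scalar (l : IntPoly) : PolyTensor := fun a c b e => if a = b ∧ c = e then l else []

/-- A polynomial multiple of a tensor. -/
def smul (l : IntPoly) (X : PolyTensor) : PolyTensor := fun a c b e => IntPoly.mul l (X a c b e)

/-- Whether two tensors are equal. -/
def same (X Y : PolyTensor) : Bool :=
  all4 fun a => all4 fun c => all4 fun b => all4 fun e => IntPoly.same (X a c b e) (Y a c b e)

/-- The value of a tensor at a real number, as a matrix. -/
noncomputable def toMatrix (u : ℝ) (X : PolyTensor) : Matrix (Idx × Idx) (Idx × Idx) ℝ :=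
  fun i j => ev u (X i.1 i.2 j.1 j.2)

variable (u : ℝ)

theorem toMatrix_mul (X Y : PolyTensor) :
    toMatrix u (mul X Y) = toMatrix u X * toMatrix u Y := by
  ext i j
  simp only [toMatrix, mul, ev_sum4, ev_mul, Matrix.mul_apply, Fintype.sum_prod_type]

theorem toMatrix_add (X Y : PolyTensor) :
    toMatrix u (add X Y) = toMatrix u X + toMatrix u Y := by
  ext i j
  simp only [toMatrix, add, ev_add, Matrix.add_apply]

theorem toMatrix_smul (l : IntPoly) (X : PolyTensor) :
    toMatrix u (smul l X) = ev u l • toMatrix u X := by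
  ext i j
  simp only [toMatrix, smul, ev_mul, Matrix.smul_apply, smul_eq_mul]

theorem toMatrix_scalar (l : IntPoly) : toMatrix u (scalar l) = ev u l • 1 := by
  ext i j
  simp only [toMatrix, scalar, Matrix.smul_apply, Matrix.one_apply, smul_eq_mul, Prod.ext_iff]
  split_ifs <;> simp [ev]

theorem toMatrix_of_same {X Y : PolyTensor} (h : same X Y = true) :
    toMatrix u X = toMatrix u Y := by
  ext i j
  exact ev_of_same u
    (forall_of_all4 (forall_of_all4 (forall_of_all4 (forall_of_all4 h i.1) i.2) j.1) j.2)

end PolyTensor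

/-! ### The R-matrices -/

/-- The `SU_q(2)` R-matrix, times `q`. -/
def suRPoly (i j : Fin 2 × Fin 2) : IntPoly :=
  if i = j then (if i.1 = i.2 then [0, 0, 1] else [0, 1])
  else if i = (0, 1) ∧ j = (1, 0) then [-1, 0, 1] else []

/-- The inverse of the `SU_q(2)` R-matrix, times `q`. -/
def suRInvPoly (i j : Fin 2 × Fin 2) : IntPoly :=
  if i = j then (if i.1 = i.2 then [1] else [0, 1])
  else if i = (0, 1) ∧ j = (1, 0) then [1, 0, -1] else []

/-- The tensor `((R^{t₂})⁻¹)^{t₂}`, times `q ^ 3`. -/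
def suRTildePoly (i j : Fin 2 × Fin 2) : IntPoly :=
  if i = j then (if i.1 = i.2 then [0, 0, 1] else [0, 0, 0, 1])
  else if i = (0, 1) ∧ j = (1, 0) then [1, 0, -1] else []

theorem suR_eq {q : ℝ} (hq : q ≠ 0) (i j : Fin 2 × Fin 2) :
    suR q i j = q⁻¹ * ev q (suRPoly i j) := by
  simp only [suR, suRPoly]
  split_ifs <;> simp [ev] <;> field_simp
  ring

theorem suR_inv_eq {q : ℝ} (hq : q ≠ 0) (i j : Fin 2 × Fin 2) :
    (suR q)⁻¹ i j = q⁻¹ * ev q (suRInvPoly i j) := by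
  have h : suR q * Matrix.of (fun i j => q⁻¹ * ev q (suRInvPoly i j)) = 1 := by
    ext ⟨i, i'⟩ ⟨j, j'⟩
    simp only [Matrix.mul_apply, Fintype.sum_prod_type, Fin.sum_univ_two, Matrix.of_apply,
      suR_eq hq, Matrix.one_apply]
    fin_cases i <;> fin_cases i' <;> fin_cases j <;> fin_cases j' <;>
      simp [suRPoly, suRInvPoly, ev] <;> field_simp
    all_goals ring
  rw [Matrix.inv_eq_right_inv h, Matrix.of_apply]

theorem suRTilde_eq {q : ℝ} (hq : q ≠ 0) (i j : Fin 2 × Fin 2) :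
    suRTilde q i j = (q ^ 3)⁻¹ * ev q (suRTildePoly i j) := by
  have h : transposeSnd (suR q) *
      transposeSnd (fun i j => (q ^ 3)⁻¹ * ev q (suRTildePoly i j)) = 1 := by
    ext ⟨i, i'⟩ ⟨j, j'⟩
    simp only [Matrix.mul_apply, Fintype.sum_prod_type, Fin.sum_univ_two, transposeSnd,
      suR_eq hq, Matrix.one_apply]
    fin_cases i <;> fin_cases i' <;> fin_cases j <;> fin_cases j' <;>
      simp [suRPoly, suRTildePoly, ev] <;> field_simp <;> ring
  rw [suRTilde, Matrix.inv_eq_right_inv h]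
  rfl

/-- The R-matrix `R_L`, times `q ^ 6`. -/
def RLPoly (a b c d : Fin 4) : IntPoly :=
  sum2 fun i => sum2 fun j => mul (suRPoly (fstI c, i) (j, fstI b)) <|
    sum2 fun k => mul (suRPoly (sndI b, j) (k, fstI a)) <|
      sum2 fun l => mul (suRPoly (sndI a, k) (l, sndI d)) (suRTildePoly (l, fstI d) (sndI c, i))

/-- The R-matrix `R_M`, times `q ^ 6`. -/
def RMPoly (a b c d : Fin 4) : IntPoly :=
  sum2 fun l => sum2 fun i => mul (suRInvPoly (l, fstI c) (fstI b, i)) <|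
    sum2 fun j => mul (suRPoly (sndI b, i) (j, fstI a)) <|
      sum2 fun k => mul (suRPoly (sndI a, j) (k, sndI d)) (suRTildePoly (k, fstI d) (sndI c, l))

/-- The two leading zeros are a factor q², so the scale drops from q⁶ to the q⁴ of the table. The
first two indices are exchanged because the table describes the R-matrix after the flip. -/
theorem RLPoly_check : (all4 fun a => all4 fun c => all4 fun b => all4 fun e =>
    same (RLPoly c a b e) (0 :: 0 :: expand (braidPoly a c b e))) = true := by
  decide +kernel

theorem RMPoly_check : (all4 fun a => all4 fun c => all4 fun b => all4 fun e =>
    same (RMPoly c a b e) (0 :: 0 :: expand (relPoly a c b e))) = true := by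
  decide +kernel

theorem RL_eq {q : ℝ} (hq : q ≠ 0) (a b c d : Idx) :
    RL q a b c d = ((q ^ 2) ^ 2)⁻¹ * ev (q ^ 2) (braidPoly b a c d) := by
  have h := ev_of_same q (forall_of_all4 (forall_of_all4 (forall_of_all4
    (forall_of_all4 RLPoly_check b) a) c) d)
  -- Three factors of scale q and one of scale q³ make q⁶.
  have h' : RL q a b c d = (q ^ 6)⁻¹ * ev q (RLPoly a b c d) := by
    simp only [RL, RLPoly, suR_eq hq, suRTilde_eq hq, ev_sum2, ev_mul, Finset.mul_sum]
    refine Finset.sum_congr rfl fun i _ => Finset.sum_congr rfl fun j _ =>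
      Finset.sum_congr rfl fun k _ => Finset.sum_congr rfl fun l _ => ?_
    field_simp
  rw [h', h]
  simp only [ev, ev_expand, Int.cast_zero]
  field_simp
  ring

theorem RM_eq {q : ℝ} (hq : q ≠ 0) (a b c d : Idx) :
    RM q a b c d = ((q ^ 2) ^ 2)⁻¹ * ev (q ^ 2) (relPoly b a c d) := by
  have h := ev_of_same q (forall_of_all4 (forall_of_all4 (forall_of_all4
    (forall_of_all4 RMPoly_check b) a) c) d)
  have h' : RM q a b c d = (q ^ 6)⁻¹ * ev q (RMPoly a b c d) := by
    simp only [RM, RMPoly, suR_eq hq, suR_inv_eq hq, suRTilde_eq hq, ev_sum2, ev_mul,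
      Finset.mul_sum]
    simp only [Fin.sum_univ_two]
    field_simp
    ring
  rw [h', h]
  simp only [ev, ev_expand, Int.cast_zero]
  field_simp
  ring

/-! ### The metric and the antisymmetric tensor -/

/-- The metric `ε_{AC} R^{A'C}_{DB} ε^{DB'}`, times `q ^ 2`. -/
def metricPoly (a b : Fin 4) : IntPoly :=
  Quad.get (Quad.get (([1, -1], [], [], [0, 1]), ([], [], [0, -1], []),
    ([], [0, 0, -1], [], []), ([0, 1], [], [], [])) a) b

/-- The inverse of the metric, times `q ^ 2`. -/
def coMetricPoly (a b : Fin 4) : IntPoly :=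
  Quad.get (Quad.get (([], [], [], [0, 1]), ([], [], [0, -1], []),
    ([], [-1], [], []), ([0, 1], [], [], [-1, 1])) a) b

theorem rawMetric_eq {q : ℝ} (hq : 0 < q) (a b : Idx) :
    rawMetric q a b = (q ^ 2)⁻¹ * ev (q ^ 2) (metricPoly a b) := by
  have h : √q ≠ 0 := (Real.sqrt_pos.2 hq).ne'
  have h2 : √q * √q = q := Real.mul_self_sqrt hq.le
  have h3 : q ≠ 0 := hq.ne'
  simp only [rawMetric, Fin.sum_univ_two, spinorMetricUp, suR_eq h3]
  fin_cases a <;> fin_cases b <;>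
    simp [spinorMetric, fstI, sndI, suRPoly, metricPoly, Quad.get, ev] <;> field_simp <;>
    simp only [Real.sq_sqrt hq.le] <;> ring

theorem metricDown_eq {q : ℝ} (hq : 0 < q) (a b : Idx) :
    metricDown q a b = (q + q⁻¹) * ((q ^ 2)⁻¹ * ev (q ^ 2) (coMetricPoly a b)) := by
  have h3 : q ≠ 0 := hq.ne'
  have h4 : q + q⁻¹ ≠ 0 := by positivity
  have h : metricUp q * Matrix.transpose (Matrix.of
      fun a b => (q + q⁻¹) * ((q ^ 2)⁻¹ * ev (q ^ 2) (coMetricPoly a b))) = 1 := by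
    ext i j
    simp only [Matrix.mul_apply, Fin.sum_univ_four, Matrix.transpose_apply, Matrix.of_apply,
      metricUp,
      rawMetric_eq hq]
    have e : ∀ x y : ℝ, (q + q⁻¹)⁻¹ * ((q ^ 2)⁻¹ * x) * ((q + q⁻¹) * ((q ^ 2)⁻¹ * y)) =
        (q ^ 4)⁻¹ * (x * y) := by intro x y; field_simp
    simp only [e]
    fin_cases i <;> fin_cases j <;>
      simp [metricPoly, coMetricPoly, Quad.get, ev] <;> field_simp <;> ring
  rw [metricDown, Matrix.inv_eq_right_inv h]
  rfl

/-- The antisymmetric tensor, times `q ^ 2`, with the keys of `epsTable`. -/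
def epsPolyTable : List (ℕ × IntPoly) :=
  [(1234, [0,1]), (1243, [-1]), (1324, [0,-1]), (1342, [0,0,1]), (1414, [0,1,-1]),
    (1423, [0,1]), (1432, [0,-1]), (1444, [-1,1]), (2134, [0,-1]), (2143, [1]),
    (2314, [0,1]), (2341, [0,-1]), (2413, [-1]), (2431, [1]), (2434, [1,-1]),
    (3124, [0,1]), (3142, [0,0,-1]), (3214, [0,-1]), (3241, [0,1]), (3412, [0,0,1]),
    (3421, [0,0,-1]), (3424, [0,1,-1]), (4123, [0,-1]), (4132, [0,1]), (4141, [0,-1,1]),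
    (4144, [1,-1]), (4213, [0,1]), (4231, [0,-1]), (4243, [-1,1]), (4312, [0,-1]),
    (4321, [0,1]), (4342, [0,-1,1]), (4414, [-1,1]), (4441, [1,-1])]

/-- The antisymmetric tensor `ε_{abcd}`, times `q ^ 2`. -/
def epsPoly (a b c d : Fin 4) : IntPoly :=
  epsPolyTable.foldr (fun e l =>
    if e.1 = 1000 * (a.val + 1) + 100 * (b.val + 1) + 10 * (c.val + 1) + (d.val + 1)
    then add e.2 l else l) []

theorem epsTable_eq {q : ℝ} (hq : q ≠ 0) :
    epsTable q = epsPolyTable.map fun e => (e.1, (q ^ 2)⁻¹ * ev (q ^ 2) e.2) := by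
  have h1 : (q ^ 2)⁻¹ * q ^ 2 = 1 := inv_mul_cancel₀ (pow_ne_zero 2 hq)
  have h2 : (q ^ 2)⁻¹ * (q ^ 2 * q ^ 2) = q ^ 2 := by rw [← mul_assoc, h1, one_mul]
  simp [epsTable, epsPolyTable, ev, mul_add, h1, h2, ← sub_eq_add_neg, sub_eq_neg_add]

theorem epsDown_eq {q : ℝ} (hq : q ≠ 0) (a b c d : Idx) :
    epsDown q [a, b, c, d] = (q ^ 2)⁻¹ * ev (q ^ 2) (epsPoly a b c d) := by
  rw [epsDown, epsTable_eq hq, epsPoly]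
  induction epsPolyTable with
  | nil => simp [ev]
  | cons e l ih =>
    simp only [List.map_cons, List.sum_cons, List.foldr_cons, ih]
    split_ifs
    · rw [ev_add, mul_add ((q ^ 2)⁻¹)]
    · rw [zero_add]

/-- The antisymmetric tensor `ε^{abcd}`, times `q ^ 10`. -/
def epsUpPoly (a b c d : Fin 4) : IntPoly :=
  sum4 fun i => mul (metricPoly i a) <| sum4 fun j => mul (metricPoly j b) <|
    sum4 fun k => mul (metricPoly k c) <| sum4 fun l => mul (metricPoly l d) (epsPoly i j k l)

theorem epsUp_eq {q : ℝ} (hq : 0 < q) (a b c d : Idx) :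
    epsUp q [a, b, c, d] = ((q ^ 2) ^ 5)⁻¹ * ev (q ^ 2) (epsUpPoly a b c d) := by
  simp only [epsUp, epsUpPoly, ev_sum4, ev_mul, Finset.mul_sum, epsDown_eq hq.ne',
    rawMetric_eq hq]
  refine Finset.sum_congr rfl fun i _ => Finset.sum_congr rfl fun j _ =>
    Finset.sum_congr rfl fun k _ => Finset.sum_congr rfl fun l _ => ?_
  field_simp

/-- The scales q² and q¹⁰ of the two tensors combine to (q²)⁶, which accounts for the six zeros; the
remaining coefficients are those of -n₁ = -2(1 + q² + q⁴). -/
theorem eps_contract_check : (all4 fun a => all4 fun e =>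
    same (sum4 fun b => sum4 fun c => sum4 fun d => mul (epsPoly b c d e) (epsUpPoly d c b a))
      (if a = e then [0, 0, 0, 0, 0, 0, -2, -2, -2] else [])) = true := by
  decide +kernel

theorem sum_epsUp_mul_epsDown {q : ℝ} (hq : 0 < q) (a e : Idx) :
    ∑ b : Idx, ∑ c : Idx, ∑ d : Idx, epsUp q [d, c, b, a] * epsDown q [b, c, d, e] =
      if a = e then -normFactor q 1 else 0 := by
  have h := ev_of_same (q ^ 2) (forall_of_all4 (forall_of_all4 eps_contract_check a) e)
  have h3 : q ≠ 0 := hq.ne'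
  simp only [ev_sum4, ev_mul] at h
  simp only [epsUp_eq hq, epsDown_eq h3]
  have e' : ∀ x y : ℝ, ((q ^ 2) ^ 5)⁻¹ * x * ((q ^ 2)⁻¹ * y) = ((q ^ 2) ^ 6)⁻¹ * (y * x) := by
    intro x y; field_simp
  simp only [e', ← Finset.mul_sum, h]
  split_ifs
  · simp [ev, normFactor]; field_simp; ring
  · simp [ev]

end QMinkowski

/-! ### Spectral, braid and metric identities over the reals -/

namespace QMinkowski
open IntPoly

/-! ### Identities for the braidings and the metric -/

/-- The braiding of two coordinates defined by `R_L`. -/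
noncomputable def braid (q : ℝ) : Matrix (Idx × Idx) (Idx × Idx) ℝ :=
  fun i j => RL q i.2 i.1 j.1 j.2

/-- The braiding of two coordinates defined by `R_M`. -/
noncomputable def relMat (q : ℝ) : Matrix (Idx × Idx) (Idx × Idx) ℝ :=
  fun i j => RM q i.2 i.1 j.1 j.2

/-- The map `(a, b) ↦ (bar b, bar a)` on pairs of indices. -/
def barSwap (i : Fin 4 × Fin 4) : Fin 4 × Fin 4 := (bar i.2, bar i.1)

theorem bar_bar (a : Idx) : bar (bar a) = a := by
  fin_cases a <;> rfl

theorem barSwap_barSwap (i : Idx × Idx) : barSwap (barSwap i) = i := by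
  simp [barSwap, bar_bar]

/-- A vector which spans the range of the trace part of the braiding. -/
def conePoly (a c : Fin 4) : IntPoly :=
  Quad.get (Quad.get (([0, 1, -2, 1], [], [], [0, 0, 1, -1]), ([], [], [0, 0, -1, 1], []),
    ([], [0, 0, 0, -1, 1], [], []), ([0, 0, 1, -1], [], [], [])) a) c

theorem braid_relation_check : PolyTensor.same
    (PolyTensor.mul (PolyTensor.add braidPoly (.scalar [0, 0, 1]))
      (PolyTensor.add (.scalar [0, 0, -1]) relPoly)) (.scalar []) = true := by
  decide +kernel

theorem braid_quadratic_check : PolyTensor.same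
    (PolyTensor.mul (PolyTensor.add braidPoly (.scalar [0, 0, 0, -1]))
      (PolyTensor.add braidPoly (.scalar [0, -1])))
    (PolyTensor.mul (PolyTensor.add (.scalar [0, 0, 1]) (.smul [-1] relPoly))
      (PolyTensor.add relPoly (.scalar [0, 1, 1, 1]))) = true := by
  decide +kernel

theorem braid_cone_check : PolyTensor.same
    (PolyTensor.add (.smul [0, 1, 1] (PolyTensor.add braidPoly (.scalar [0, 0, 0, -1])))
      (PolyTensor.mul (PolyTensor.add braidPoly (.scalar [0, 0, 0, -1]))
        (PolyTensor.add braidPoly (.scalar [0, -1]))))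
    (fun a c b e => mul (conePoly a c) (coMetricPoly e b)) = true := by
  decide +kernel

theorem relMat_bar_check : PolyTensor.same
    (PolyTensor.mul (fun a c b e => relPoly (bar c) (bar a) (bar e) (bar b)) relPoly)
      (.scalar [0, 0, 0, 0, 1]) = true := by
  decide +kernel

theorem relMat_metric_check : PolyTensor.same
    (fun a' b' c d => sum4 fun a => mul (metricPoly a a') <|
      sum4 fun b => mul (metricPoly b b') (relPoly c d b a))
    (fun a' b' c d => sum4 fun e => mul (metricPoly d e) <|
      sum4 fun f => mul (metricPoly c f) (relPoly a' b' e f)) = true := by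
  decide +kernel

variable {q : ℝ}

theorem braid_eq (hq : q ≠ 0) :
    braid q = ((q ^ 2) ^ 2)⁻¹ • PolyTensor.toMatrix (q ^ 2) braidPoly := by
  ext i j
  exact RL_eq hq _ _ _ _

theorem relMat_eq (hq : q ≠ 0) :
    relMat q = ((q ^ 2) ^ 2)⁻¹ • PolyTensor.toMatrix (q ^ 2) relPoly := by
  ext i j
  exact RM_eq hq _ _ _ _

theorem toMatrix_braidPoly (hq : q ≠ 0) :
    PolyTensor.toMatrix (q ^ 2) braidPoly = (q ^ 2) ^ 2 • braid q := by
  rw [braid_eq hq, smul_inv_smul₀ (by positivity)]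

theorem toMatrix_relPoly (hq : q ≠ 0) :
    PolyTensor.toMatrix (q ^ 2) relPoly = (q ^ 2) ^ 2 • relMat q := by
  rw [relMat_eq hq, smul_inv_smul₀ (by positivity)]

/-- The range of 1 - M lies in the eigenspace of B for -1. This compatibility cancels the derivative
of a relation in degree two, and later lets the relations be rewritten through B. -/
theorem one_add_braid_mul (hq : q ≠ 0) : (1 + braid q) * (1 - relMat q) = 0 := by
  have h := PolyTensor.toMatrix_of_same (q ^ 2) braid_relation_check
  simp only [PolyTensor.toMatrix_mul, PolyTensor.toMatrix_add, PolyTensor.toMatrix_scalar,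
    toMatrix_braidPoly hq, toMatrix_relPoly hq] at h
  have e1 : ev (q ^ 2) [0, 0, 1] = (q ^ 2) ^ 2 := by simp [ev]; ring
  have e2 : ev (q ^ 2) [0, 0, -1] = -(q ^ 2) ^ 2 := by simp [ev]; ring
  have e3 : ev (q ^ 2) [] = 0 := rfl
  rw [e1, e2, e3] at h
  -- Each of the two factors carries q⁴, so the table identity is (q²)⁴ times the claim.
  refine smul_right_injective _ (pow_ne_zero 4 (pow_ne_zero 2 hq)) ?_
  simp only [add_mul, mul_add, sub_eq_add_neg, mul_neg, smul_mul_smul_comm, mul_one,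
    one_mul] at h ⊢
  linear_combination (norm := module) (-1 : ℝ) • h

/-- The polynomial in B on the left vanishes on the eigenvalues q² and q⁻². Since it is divisible by
1 - M, products of momenta see only these two eigenvalues. -/
theorem braid_quadratic (hq : q ≠ 0) :
    (braid q - q ^ 2 • 1) * (q ^ 2 • braid q - 1) =
      (1 - relMat q) * (q ^ 2 • relMat q + (1 + q ^ 2 + q ^ 4) • 1) := by
  have h := PolyTensor.toMatrix_of_same (q ^ 2) braid_quadratic_check
  simp only [PolyTensor.toMatrix_mul, PolyTensor.toMatrix_add, PolyTensor.toMatrix_scalar,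
    PolyTensor.toMatrix_smul, toMatrix_braidPoly hq, toMatrix_relPoly hq] at h
  have e1 : ev (q ^ 2) [0, 0, 0, -1] = -(q ^ 2) ^ 3 := by simp [ev]; ring
  have e2 : ev (q ^ 2) [0, -1] = -q ^ 2 := by simp [ev]
  have e3 : ev (q ^ 2) [0, 0, 1] = (q ^ 2) ^ 2 := by simp [ev]; ring
  have e4 : ev (q ^ 2) [-1] = -1 := by simp [ev]
  have e5 : ev (q ^ 2) [0, 1, 1, 1] = q ^ 2 + q ^ 4 + q ^ 6 := by simp [ev]; ring
  rw [e1, e2, e3, e4, e5] at h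
  -- The common factor is (q²)³, as q⁴B - q⁶ = q⁴(B - q²) and q⁴B - q² = q²(q²B - 1).
  refine smul_right_injective _ (pow_ne_zero 3 (pow_ne_zero 2 hq)) ?_
  simp only [add_mul, mul_add, sub_eq_add_neg, neg_mul, mul_neg, mul_one, one_mul,
    smul_mul_assoc, mul_smul_comm] at h ⊢
  linear_combination (norm := module) (1 : ℝ) • h

/-- The left side equals q²(B - q²)(B + 1), which isolates the eigenvalue q⁻². Its rank is one and
its kernel contains every column with vanishing metric contraction, so the cone relation removes
this eigenvalue. -/
theorem braid_cone (hq : 0 < q) : ∃ w : Idx × Idx → ℝ,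
    (1 + q ^ 2) • (braid q - q ^ 2 • 1) + (braid q - q ^ 2 • 1) * (q ^ 2 • braid q - 1) =
      Matrix.of fun i j => w i * metricDown q j.2 j.1 := by
  have hq' := hq.ne'
  have h := PolyTensor.toMatrix_of_same (q ^ 2) braid_cone_check
  simp only [PolyTensor.toMatrix_mul, PolyTensor.toMatrix_add, PolyTensor.toMatrix_scalar,
    PolyTensor.toMatrix_smul, toMatrix_braidPoly hq'] at h
  have e1 : ev (q ^ 2) [0, 0, 0, -1] = -(q ^ 2) ^ 3 := by simp [ev]; ring
  have e2 : ev (q ^ 2) [0, -1] = -q ^ 2 := by simp [ev]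
  have e3 : ev (q ^ 2) [0, 1, 1] = q ^ 2 + q ^ 4 := by simp [ev]; ring
  rw [e1, e2, e3] at h
  have h1 : q + q⁻¹ ≠ 0 := by positivity
  -- The factor (q + q⁻¹)⁻¹ undoes the normalisation of `metricDown`; the power of q adjusts the
  -- scale of the table.
  let w : Idx × Idx → ℝ := fun i =>
    (q + q⁻¹)⁻¹ * ((q ^ 2) ^ 2)⁻¹ * ev (q ^ 2) (conePoly i.1 i.2)
  have hw : PolyTensor.toMatrix (q ^ 2)
      (fun a c b e => mul (conePoly a c) (coMetricPoly e b)) =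
      (q ^ 2) ^ 3 • Matrix.of fun i j => w i * metricDown q j.2 j.1 := by
    ext i j
    simp only [PolyTensor.toMatrix, ev_mul, Matrix.smul_apply, Matrix.of_apply,
      metricDown_eq hq, smul_eq_mul, w]
    field_simp
  rw [hw] at h
  refine ⟨w, smul_right_injective _ (pow_ne_zero 3 (pow_ne_zero 2 hq')) ?_⟩
  simp only [add_mul, mul_add, sub_eq_add_neg, neg_mul, mul_neg, mul_one, one_mul,
    smul_mul_assoc, mul_smul_comm] at h ⊢
  linear_combination (norm := module) (1 : ℝ) • h

/-- Reversing and barring a product inverts the reordering by M; the star structures rest on this.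
-/
theorem relMat_bar_mul (hq : q ≠ 0) :
    (relMat q).submatrix barSwap barSwap * relMat q = 1 := by
  have h := PolyTensor.toMatrix_of_same (q ^ 2) relMat_bar_check
  have hb : PolyTensor.toMatrix (q ^ 2) (fun a c b e => relPoly (bar c) (bar a) (bar e) (bar b)) =
      (PolyTensor.toMatrix (q ^ 2) relPoly).submatrix barSwap barSwap := rfl
  have e1 : ev (q ^ 2) [0, 0, 0, 0, 1] = (q ^ 2) ^ 4 := by simp [ev]; ring
  rw [PolyTensor.toMatrix_mul, PolyTensor.toMatrix_scalar, hb, toMatrix_relPoly hq,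
    Matrix.submatrix_smul, e1] at h
  refine smul_right_injective _ (pow_ne_zero 4 (pow_ne_zero 2 hq)) ?_
  simp only [Pi.smul_apply, smul_mul_smul_comm] at h ⊢
  linear_combination (norm := module) (1 : ℝ) • h

theorem mixed_braid_relation (hq : q ≠ 0) (a c c' b d d' : Idx) :
    ∑ m : Idx, ∑ n : Idx, ∑ k : Idx, RL q c a m n * (RL q c' n k d' * RM q k m b d) =
      ∑ m : Idx, ∑ n : Idx, ∑ k : Idx, RM q c' c m n * (RL q m a b k * RL q n k d d') := by
  have h := ev_of_same (q ^ 2) (forall_of_all4 (forall_of_all4 (forall_of_all4 (forall_of_all4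
    (forall_of_all4 (forall_of_all4 mixed_check a) c) c') b) d) d')
  simp only [ev_sum4, ev_mul, Finset.mul_sum] at h
  simp only [RL_eq hq, RM_eq hq]
  have e : ∀ x y z : ℝ, ((q ^ 2) ^ 2)⁻¹ * x * (((q ^ 2) ^ 2)⁻¹ * y * (((q ^ 2) ^ 2)⁻¹ * z)) =
      ((q ^ 2) ^ 6)⁻¹ * (x * (y * z)) := by intro x y z; field_simp
  simp only [e, ← Finset.mul_sum] at h ⊢
  rw [h]

theorem metricUp_mul (hq : 0 < q) (a c : Idx) :
    ∑ b : Idx, metricUp q a b * metricDown q c b = if a = c then 1 else 0 := by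
  have h3 : q ≠ 0 := hq.ne'
  have h4 : q + q⁻¹ ≠ 0 := by positivity
  have e : ∀ x y : ℝ, (q + q⁻¹)⁻¹ * ((q ^ 2)⁻¹ * x) * ((q + q⁻¹) * ((q ^ 2)⁻¹ * y)) =
      (q ^ 4)⁻¹ * (x * y) := by intro x y; field_simp
  simp only [Fin.sum_univ_four, metricUp, rawMetric_eq hq, metricDown_eq hq, e]
  fin_cases a <;> fin_cases c <;>
    simp [metricPoly, coMetricPoly, Quad.get, ev] <;> field_simp <;> ring

theorem metricUp_mul_transpose (hq : 0 < q) : metricUp q * (metricDown q).transpose = 1 := by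
  ext a c
  rw [Matrix.mul_apply, Matrix.one_apply]
  exact metricUp_mul hq a c

theorem metricDown_transpose_mul (hq : 0 < q) (a c : Idx) :
    ∑ b : Idx, metricDown q b a * metricUp q b c = if a = c then 1 else 0 := by
  have h1 := mul_eq_one_comm.1 (metricUp_mul_transpose hq)
  have h := congrFun (congrFun h1 a) c
  rwa [Matrix.mul_apply, Matrix.one_apply] at h

theorem metricDown_bar (hq : 0 < q) (a b : Idx) :
    metricDown q (bar a) (bar b) = metricDown q b a := by
  rw [metricDown_eq hq, metricDown_eq hq]
  congr 3
  fin_cases a <;> fin_cases b <;> rfl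

theorem relMat_metricUp (hq : 0 < q) (a' b' c d : Idx) :
    ∑ a : Idx, ∑ b : Idx, metricUp q a a' * (metricUp q b b' * RM q d c b a) =
      ∑ e : Idx, ∑ f : Idx, metricUp q d e * (metricUp q c f * RM q b' a' e f) := by
  have h := ev_of_same (q ^ 2) (forall_of_all4 (forall_of_all4 (forall_of_all4 (forall_of_all4
    relMat_metric_check a') b') c) d)
  simp only [ev_sum4, ev_mul, Finset.mul_sum] at h
  have e : ∀ x y z : ℝ, (q + q⁻¹)⁻¹ * ((q ^ 2)⁻¹ * x) * ((q + q⁻¹)⁻¹ * ((q ^ 2)⁻¹ * y) *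
      (((q ^ 2) ^ 2)⁻¹ * z)) = ((q + q⁻¹) ^ 2 * (q ^ 2) ^ 4)⁻¹ * (x * (y * z)) := by
    intro x y z; field_simp
  simp only [metricUp, rawMetric_eq hq, RM_eq hq.ne', e, ← Finset.mul_sum] at h ⊢
  rw [h]

theorem sum_fin_succ_fun {α N : Type*} [Fintype α] [AddCommMonoid N] {n : ℕ}
    (F : (Fin (n + 1) → α) → N) :
    ∑ f, F f = ∑ a, ∑ f : Fin n → α, F (Fin.cons a f) := by
  rw [← Fintype.sum_prod_type', ← (Fin.consEquiv fun _ : Fin (n + 1) => α).sum_comp]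
  rfl

/-- The contraction of the two antisymmetric tensors is -n₁ times the identity, and the sign (-1)¹
and the division by n₁ cancel it. Hence the differential of a function needs no antisymmetrisation.
-/
theorem antisym_one (hq : 0 < q) (u v : Fin 1 → Idx) :
    antisym q 1 u v = if u 0 = v 0 then 1 else 0 := by
  have h1 : normFactor q 1 ≠ 0 := by simp only [normFactor]; positivity
  have h := sum_epsUp_mul_epsDown hq (u 0) (v 0)
  have h2 : ∑ s : Fin (4 - 1) → Idx,
      epsUp q (List.ofFn u ++ List.ofFn s).reverse * epsDown q (List.ofFn s ++ List.ofFn v) =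
      ∑ b : Idx, ∑ c : Idx, ∑ d : Idx,
        epsUp q [d, c, b, u 0] * epsDown q [b, c, d, v 0] := by
    rw [sum_fin_succ_fun]
    refine Finset.sum_congr rfl fun b _ => ?_
    rw [sum_fin_succ_fun]
    refine Finset.sum_congr rfl fun c _ => ?_
    rw [sum_fin_succ_fun]
    refine Finset.sum_congr rfl fun d _ => ?_
    simp
  rw [antisym, if_neg one_ne_zero, if_pos (by norm_num), h2, h]
  split_ifs
  · field_simp
  · simp

end QMinkowski

/-! ### Coordinate and momentum relations in an arbitrary algebra -/

namespace QMinkowski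
open scoped Kronecker

/-! ### Coordinates and momenta in an algebra -/

section Algebra

variable {E : Type*} [Semiring E] [Algebra ℂ E] {q : ℝ}

variable (E) in
/-- The real scalars of a complex algebra. -/
noncomputable def realScalar : ℝ →+* E := (algebraMap ℂ E).comp Complex.ofRealHom

theorem realScalar_mul (r : ℝ) (z : E) : realScalar E r * z = (r : ℂ) • z :=
  (Algebra.smul_def _ _).symm

theorem mul_realScalar (r : ℝ) (z : E) : z * realScalar E r = (r : ℂ) • z := by
  rw [← realScalar_mul]
  exact (Algebra.commutes _ _).symm

variable (E) in
/-- A real matrix as a matrix with entries in a complex algebra. -/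
noncomputable def scalarMatrix :
    Matrix (Idx × Idx) (Idx × Idx) ℝ →+* Matrix (Idx × Idx) (Idx × Idx) E :=
  (realScalar E).mapMatrix

theorem scalarMatrix_apply (M : Matrix (Idx × Idx) (Idx × Idx) ℝ) (i j : Idx × Idx) :
    scalarMatrix E M i j = realScalar E (M i j) := rfl

variable (q) in
/-- Elements of an algebra which satisfy the relations of the coordinates of `M_q`. -/
def IsCoordinate (y : Idx → E) : Prop :=
  ∀ a b, y a * y b = ∑ c : Idx, ∑ d : Idx, (RM q c d a b : ℂ) • (y d * y c)

variable (q) in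
/-- Elements of an algebra which satisfy the relations of the momenta of `V(R_M)`. -/
def IsMomentum (y : Idx → E) : Prop :=
  ∀ a b, y a * y b = ∑ c : Idx, ∑ d : Idx, (RM q a b c d : ℂ) • (y d * y c)

/-- The products of two elements of a family. -/
def pairProd (y : Idx → E) : Idx × Idx → E := fun i => y i.1 * y i.2

theorem isCoordinate_iff (y : Idx → E) :
    IsCoordinate q y ↔
      Matrix.vecMul (pairProd y) (scalarMatrix E (relMat q)) = pairProd y := by
  have h : ∀ j : Idx × Idx, Matrix.vecMul (pairProd y) (scalarMatrix E (relMat q)) j =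
      ∑ c : Idx, ∑ d : Idx, (RM q c d j.1 j.2 : ℂ) • (y d * y c) := by
    intro j
    simp only [Matrix.vecMul, dotProduct, Fintype.sum_prod_type, scalarMatrix_apply,
      mul_realScalar]
    exact Finset.sum_comm
  constructor
  · intro hy
    ext j
    rw [h, pairProd, hy]
  · intro hy a b
    rw [← h (a, b), hy, pairProd]

/-- The products are listed in reversed order so that the flip built into `relMat` matches the order
p^d p^c in the relations. -/
theorem isMomentum_iff (y : Idx → E) :
    IsMomentum q y ↔
      (scalarMatrix E (relMat q)).mulVec (fun i => y i.2 * y i.1) = fun i => y i.2 * y i.1 := by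
  have h : ∀ j : Idx × Idx,
      (scalarMatrix E (relMat q)).mulVec (fun i => y i.2 * y i.1) j =
      ∑ c : Idx, ∑ d : Idx, (RM q j.2 j.1 c d : ℂ) • (y d * y c) := by
    intro j
    simp only [Matrix.mulVec, dotProduct, Fintype.sum_prod_type, scalarMatrix_apply,
      realScalar_mul]
    rfl
  constructor
  · intro hy
    ext j
    rw [h, hy]
  · intro hy a b
    rw [← h (b, a), hy]

theorem braid_mul_one_sub (hq : q ≠ 0) :
    braid q * (1 - relMat q) = -(1 - relMat q) := by
  have h := one_add_braid_mul hq
  rw [add_mul, one_mul] at h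
  exact eq_neg_of_add_eq_zero_right h

/-- B acts as -1 on the range of 1 - M, where (B - q²)(q²B - 1) is thus the non-zero scalar (1 +
q²)². Together with `braid_quadratic` this trades 1 - M for a polynomial in B, the only matrix that
the Lorentz relations know about. -/
theorem one_sub_relMat_eq (hq : q ≠ 0) :
    1 - relMat q = (braid q - q ^ 2 • 1) * (q ^ 2 • braid q - 1) *
      (((1 + q ^ 2) ^ 2)⁻¹ • (1 - relMat q)) := by
  have h := braid_mul_one_sub hq
  have h0 : (1 + q ^ 2) ^ 2 ≠ 0 := by positivity
  rw [Matrix.mul_smul, eq_inv_smul_iff₀ h0, Matrix.mul_assoc, Matrix.sub_mul (q ^ 2 • braid q),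
    Matrix.smul_mul, h, Matrix.one_mul, Matrix.sub_mul, Matrix.mul_sub, Matrix.mul_smul,
    Matrix.mul_neg, h, Matrix.smul_mul, Matrix.one_mul]
  module

/-- The commutation relations of the quantum Lorentz group. -/
def IsLorentz (q : ℝ) (l : Idx → Idx → E) : Prop :=
  ∀ a b c d, ∑ e : Idx, ∑ f : Idx, (RL q a b e f : ℂ) • (l e c * l f d) =
    ∑ e : Idx, ∑ f : Idx, (RL q e f c d : ℂ) • (l b f * l a e)

theorem IsLorentz.commute {l : Idx → Idx → E} (hl : IsLorentz q l) :
    scalarMatrix E (braid q) * Matrix.of (fun i j => l i.1 j.1 * l i.2 j.2) =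
      Matrix.of (fun i j => l i.1 j.1 * l i.2 j.2) * scalarMatrix E (braid q) := by
  ext i j
  simp only [Matrix.mul_apply, Fintype.sum_prod_type, scalarMatrix_apply, realScalar_mul,
    mul_realScalar, Matrix.of_apply]
  refine (hl i.2 i.1 j.1 j.2).trans Finset.sum_comm

/-- Let T be the matrix of products of two Lorentz generators and f(B) = (B - q²)(q²B - 1). The
transformed row is yyT. Right multiplication by 1 - M starts with f(B), which commutes with T by the
FRT relation; moved to the left it becomes (1 - M)(…), which kills yy. -/
theorem IsCoordinate.transform (hq : q ≠ 0) {y : Idx → E} (hy : IsCoordinate q y)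
    {l : Idx → Idx → E} (hl : IsLorentz q l) (hc : ∀ a b c, Commute (y a) (l b c)) :
    IsCoordinate q fun a => ∑ b, y b * l b a := by
  -- Negatives come from the scalar -1; they are needed to write the relations with 1 - M.
  let _ : Ring E := Algebra.semiringToRing ℂ
  set T : Matrix (Idx × Idx) (Idx × Idx) E := Matrix.of fun i j => l i.1 j.1 * l i.2 j.2 with hT
  have hz : pairProd (fun a => ∑ b, y b * l b a) = Matrix.vecMul (pairProd y) T := by
    ext j
    simp only [pairProd, Matrix.vecMul, dotProduct, Fintype.sum_prod_type, Finset.sum_mul_sum,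
      hT, Matrix.of_apply]
    refine Finset.sum_congr rfl fun b _ => Finset.sum_congr rfl fun c _ => ?_
    rw [mul_assoc, mul_assoc, ← mul_assoc (l b j.1), ← (hc c b j.1).eq, mul_assoc]
  have hy' : Matrix.vecMul (pairProd y) (scalarMatrix E (1 - relMat q)) = 0 := by
    rw [map_sub, map_one, Matrix.vecMul_sub, Matrix.vecMul_one, (isCoordinate_iff y).1 hy, sub_self]
  have hcomm : Commute (scalarMatrix E ((braid q - q ^ 2 • 1) * (q ^ 2 • braid q - 1))) T := by
    have h1 : Commute (scalarMatrix E (braid q)) T := hl.commute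
    have h2 : ∀ r : ℝ, Commute (scalarMatrix E (r • 1)) T := by
      intro r
      ext i j
      simp [Matrix.mul_apply, scalarMatrix_apply, Matrix.smul_apply, Matrix.one_apply,
        realScalar_mul, mul_realScalar, apply_ite (realScalar E), ite_mul, mul_ite]
    have h3 : q ^ 2 • braid q = (q ^ 2 • 1) * braid q := by simp
    rw [h3, map_mul, map_sub, map_sub, map_mul, map_one]
    exact (h1.sub_left (h2 _)).mul_left (((h2 _).mul_left h1).sub_left (Commute.one_left _))
  have key : Matrix.vecMul (pairProd fun a => ∑ b, y b * l b a)
      (scalarMatrix E (1 - relMat q)) = 0 := by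
    rw [hz, one_sub_relMat_eq hq, map_mul, ← Matrix.vecMul_vecMul, Matrix.vecMul_vecMul _ T,
      ← hcomm.eq, braid_quadratic hq, map_mul, mul_assoc, ← Matrix.vecMul_vecMul _ (scalarMatrix E (1 - relMat q)), hy', Matrix.zero_vecMul,
      Matrix.zero_vecMul]
  rw [map_sub, map_one, Matrix.vecMul_sub, Matrix.vecMul_one, sub_eq_zero] at key
  exact (isCoordinate_iff _).2 key.symm

/-- The momentum relations kill the quadratic term of `braid_cone` and the cone relation kills its
right side. What remains is (1 + q²)(B - q²) applied to the products, and 1 + q² is invertible. -/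
theorem IsMomentum.braid_mul (hq : 0 < q) {y : Idx → E} (hy : IsMomentum q y)
    (hcone : ∑ a : Idx, ∑ b : Idx, (metricDown q a b : ℂ) • (y a * y b) = 0) (a c : Idx) :
    ∑ b : Idx, ∑ d : Idx, (RL q c a b d : ℂ) • (y d * y b) = ((q ^ 2 : ℝ) : ℂ) • (y c * y a) := by
  let _ : Ring E := Algebra.semiringToRing ℂ
  set v : Idx × Idx → E := fun i => y i.2 * y i.1 with hv
  have hv1 : (scalarMatrix E (1 - relMat q)).mulVec v = 0 := by
    rw [map_sub, map_one, Matrix.sub_mulVec, Matrix.one_mulVec, (isMomentum_iff y).1 hy, sub_self]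
  have hv2 : (scalarMatrix E ((braid q - q ^ 2 • 1) * (q ^ 2 • braid q - 1))).mulVec v = 0 := by
    -- The factor 1 - M has to stand on the right to meet the column of momenta.
    have h : (1 - relMat q) * (q ^ 2 • relMat q + (1 + q ^ 2 + q ^ 4) • 1) =
        (q ^ 2 • relMat q + (1 + q ^ 2 + q ^ 4) • 1) * (1 - relMat q) := by
      simp only [sub_mul, mul_sub, add_mul, mul_add, smul_mul_assoc, mul_smul_comm, one_mul,
        mul_one]
      module
    rw [braid_quadratic hq.ne', h, map_mul, ← Matrix.mulVec_mulVec, hv1, Matrix.mulVec_zero]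
  obtain ⟨w, hw⟩ := braid_cone hq
  have hv3 : (scalarMatrix E
      (Matrix.of fun i j => w i * metricDown q j.2 j.1)).mulVec v = 0 := by
    ext i
    have h : ∑ j : Idx × Idx, (metricDown q j.2 j.1 : ℂ) • v j = 0 := by
      rw [Fintype.sum_prod_type, Finset.sum_comm]
      exact hcone
    simp only [Matrix.mulVec, dotProduct, scalarMatrix_apply, Matrix.of_apply, realScalar_mul,
      Complex.ofReal_mul, mul_smul, ← Finset.smul_sum, h, smul_zero, Pi.zero_apply]
  have hv4 : (scalarMatrix E ((1 + q ^ 2) • (braid q - q ^ 2 • 1))).mulVec v = 0 := by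
    have h := congrArg (fun M => (scalarMatrix E M).mulVec v) hw
    simpa only [map_add, Matrix.add_mulVec, hv2, hv3, add_zero] using h
  have h := congrFun hv4 (a, c)
  have h0 : ((1 + q ^ 2 : ℝ) : ℂ) ≠ 0 := by
    have : (1 + q ^ 2 : ℝ) ≠ 0 := by positivity
    exact_mod_cast this
  simp only [Matrix.mulVec, dotProduct, scalarMatrix_apply, realScalar_mul, Matrix.smul_apply,
    smul_eq_mul, Complex.ofReal_mul, mul_smul, ← Finset.smul_sum, Pi.zero_apply] at h
  have h5 := (smul_eq_zero.1 h).resolve_left h0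
  simp only [Matrix.sub_apply, Complex.ofReal_sub, sub_smul, Finset.sum_sub_distrib,
    sub_eq_zero] at h5
  rw [Fintype.sum_prod_type] at h5
  refine h5.trans ?_
  simp [Matrix.smul_apply, Matrix.one_apply, apply_ite, ite_smul, hv]

/-- The relations of the momenta and of the coordinates are exchanged by the metric. -/
theorem relMat_kronecker (hq : 0 < q) :
    (relMat q).submatrix Prod.swap Prod.swap * (metricUp q ⊗ₖ metricUp q) =
      (metricUp q ⊗ₖ metricUp q) * (relMat q).transpose := by
  ext i j
  have h := relMat_metricUp hq j.1 j.2 i.2 i.1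
  simp only [Matrix.mul_apply, Fintype.sum_prod_type, Matrix.submatrix_apply,
    Matrix.kroneckerMap_apply, Matrix.transpose_apply, relMat, Prod.fst_swap, Prod.snd_swap]
  calc _ = _ := Finset.sum_congr rfl fun a _ => Finset.sum_congr rfl fun b _ => by ring
    _ = _ := h
    _ = _ := Finset.sum_congr rfl fun a _ => Finset.sum_congr rfl fun b _ => by ring

theorem isMomentum_iff_pairProd (y : Idx → E) :
    IsMomentum q y ↔ (scalarMatrix E ((relMat q).submatrix Prod.swap Prod.swap)).mulVec
      (pairProd y) = pairProd y := by
  have h : ∀ j : Idx × Idx,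
      (scalarMatrix E ((relMat q).submatrix Prod.swap Prod.swap)).mulVec (pairProd y) j =
      ∑ c : Idx, ∑ d : Idx, (RM q j.1 j.2 c d : ℂ) • (y d * y c) := by
    intro j
    simp only [Matrix.mulVec, dotProduct, Fintype.sum_prod_type, scalarMatrix_apply,
      realScalar_mul]
    exact Finset.sum_comm
  constructor
  · intro hy
    ext j
    rw [h, pairProd, hy]
  · intro hy a b
    rw [← h (a, b), hy, pairProd]

theorem isCoordinate_iff_mulVec (y : Idx → E) :
    IsCoordinate q y ↔ (scalarMatrix E (relMat q).transpose).mulVec (pairProd y) = pairProd y := by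
  rw [isCoordinate_iff]
  have h : Matrix.vecMul (pairProd y) (scalarMatrix E (relMat q)) =
      (scalarMatrix E (relMat q).transpose).mulVec (pairProd y) := by
    ext j
    simp only [Matrix.mulVec, Matrix.vecMul, dotProduct, scalarMatrix_apply, mul_realScalar,
      realScalar_mul, Matrix.transpose_apply]
  rw [h]

theorem pairProd_linear (M : Matrix Idx Idx ℝ) (y : Idx → E) :
    pairProd (fun a => ∑ b, (M a b : ℂ) • y b) =
      (scalarMatrix E (M ⊗ₖ M)).mulVec (pairProd y) := by
  ext i
  simp only [pairProd, Matrix.mulVec, dotProduct, scalarMatrix_apply, realScalar_mul,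
    Fintype.sum_prod_type, Matrix.kroneckerMap_apply, Finset.sum_mul_sum, smul_mul_smul_comm,
    Complex.ofReal_mul]

/-- Raising and lowering reduce the coaction on momenta to the one on coordinates. -/
theorem IsCoordinate.raise (hq : 0 < q) {y : Idx → E} (hy : IsCoordinate q y) :
    IsMomentum q fun a => ∑ b, (metricUp q a b : ℂ) • y b := by
  rw [isMomentum_iff_pairProd, pairProd_linear, Matrix.mulVec_mulVec, ← map_mul,
    relMat_kronecker hq, map_mul, ← Matrix.mulVec_mulVec, (isCoordinate_iff_mulVec y).1 hy]

theorem IsMomentum.lower (hq : 0 < q) {y : Idx → E} (hy : IsMomentum q y) :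
    IsCoordinate q fun a => ∑ b, (metricDown q b a : ℂ) • y b := by
  have h1 := metricUp_mul_transpose hq
  have h2 := mul_eq_one_comm.1 h1
  set N := (metricDown q).transpose with hN
  have h3 : (metricUp q ⊗ₖ metricUp q) * (N ⊗ₖ N) = 1 := by
    rw [← Matrix.mul_kronecker_mul, h1, Matrix.one_kronecker_one]
  have h4 : (N ⊗ₖ N) * (metricUp q ⊗ₖ metricUp q) = 1 := mul_eq_one_comm.1 h3
  have h5 : (relMat q).transpose * (N ⊗ₖ N) =
      (N ⊗ₖ N) * (relMat q).submatrix Prod.swap Prod.swap := by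
    calc _ = (N ⊗ₖ N) * (metricUp q ⊗ₖ metricUp q) * ((relMat q).transpose * (N ⊗ₖ N)) := by
          rw [h4, one_mul]
      _ = (N ⊗ₖ N) * ((metricUp q ⊗ₖ metricUp q) * (relMat q).transpose) * (N ⊗ₖ N) := by
          simp only [mul_assoc]
      _ = (N ⊗ₖ N) * (relMat q).submatrix Prod.swap Prod.swap *
            ((metricUp q ⊗ₖ metricUp q) * (N ⊗ₖ N)) := by
          rw [← relMat_kronecker hq]; simp only [mul_assoc]
      _ = _ := by rw [h3, mul_one]
  change IsCoordinate q fun a => ∑ b, (N a b : ℂ) • y b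
  rw [isCoordinate_iff_mulVec, pairProd_linear, Matrix.mulVec_mulVec, ← map_mul, h5, map_mul,
    ← Matrix.mulVec_mulVec, (isMomentum_iff_pairProd y).1 hy]

end Algebra

end QMinkowski

/-! ### Presentations by generators, and the operators of the Leibniz rule -/

namespace QMinkowski

/-! ### Generators and relations -/

section Generators

variable {q : ℝ}

theorem mkM_surjective (q : ℝ) : Function.Surjective (mkM q) :=
  RingQuot.mkAlgHom_surjective ℂ (RelM q)

theorem mkP_surjective (q : ℝ) : Function.Surjective (mkP q) :=
  RingQuot.mkAlgHom_surjective ℂ (RelP q)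

theorem isCoordinate_x (q : ℝ) : IsCoordinate q (x q) := by
  intro a b
  have h := RingQuot.mkAlgHom_rel ℂ (RelM.comm (q := q) a b)
  simp only [map_mul, map_sum, map_smul] at h
  exact h

theorem isMomentum_p (q : ℝ) : IsMomentum q (p q) := by
  intro a b
  have h := RingQuot.mkAlgHom_rel ℂ (RelP.comm (q := q) a b)
  simp only [map_mul, map_sum, map_smul] at h
  exact h

theorem cone_p (q : ℝ) :
    ∑ a : Idx, ∑ b : Idx, (metricDown q a b : ℂ) • (p q a * p q b) = 0 := by
  have h := RingQuot.mkAlgHom_rel ℂ (RelP.cone (q := q))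
  simp only [map_mul, map_sum, map_smul, map_zero] at h
  exact h

theorem isLorentz_lam (q : ℝ) : IsLorentz q (lam q) := by
  intro a b c d
  have h := RingQuot.mkAlgHom_rel ℂ (RelL.frt (q := q) a b c d)
  simp only [map_mul, map_sum, map_smul] at h
  exact h

theorem lam_metric (q : ℝ) (a b : Idx) :
    ∑ c : Idx, ∑ d : Idx, (metricUp q c d : ℂ) • (lam q a c * lam q b d) =
      algebraMap ℂ _ (metricUp q a b : ℂ) := by
  have h := RingQuot.mkAlgHom_rel ℂ (RelL.metric (q := q) a b)
  simp only [map_mul, map_sum, map_smul, AlgHom.commutes] at h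
  exact h

/-- Existence of a factorisation excludes the default value 0 of `descend`; supplying one is the
whole content of well-definedness. -/
theorem descend_apply {A B C : Type*} [AddCommMonoid A] [AddCommMonoid B] [AddCommMonoid C]
    [Module ℂ A] [Module ℂ B] [Module ℂ C] {σ : ℂ →+* ℂ}
    {π : A →ₗ[ℂ] B} {φ : A →ₛₗ[σ] C} (h : ∃ ψ : B →ₛₗ[σ] C, ∀ w, ψ (π w) = φ w) (w : A) :
    descend π φ (π w) = φ w := by
  rw [descend, dif_pos h]
  exact h.choose_spec w

section Lift

variable {E : Type*} [Semiring E] [Algebra ℂ E]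

/-- The algebra map out of `M_q` given by elements which satisfy its relations. -/
noncomputable def liftM (y : Idx → E) (hy : IsCoordinate q y) : Mq q →ₐ[ℂ] E :=
  RingQuot.liftAlgHom ℂ ⟨FreeAlgebra.lift ℂ y, by
    rintro _ _ ⟨a, b⟩
    simpa only [map_mul, map_sum, map_smul, FreeAlgebra.lift_ι_apply] using hy a b⟩

theorem liftM_mkM (y : Idx → E) (hy : IsCoordinate q y) (w : FreeAlgebra ℂ Idx) :
    liftM y hy (mkM q w) = FreeAlgebra.lift ℂ y w :=
  RingQuot.liftAlgHom_mkAlgHom_apply ..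

/-- The algebra map out of `P₀` given by elements which satisfy its relations. -/
noncomputable def liftP (y : Idx → E) (hy : IsMomentum q y)
    (hc : ∑ a : Idx, ∑ b : Idx, (metricDown q a b : ℂ) • (y a * y b) = 0) : P0 q →ₐ[ℂ] E :=
  RingQuot.liftAlgHom ℂ ⟨FreeAlgebra.lift ℂ y, by
    rintro _ _ (⟨a, b⟩ | _)
    · simpa only [map_mul, map_sum, map_smul, FreeAlgebra.lift_ι_apply] using hy a b
    · simpa only [map_mul, map_sum, map_smul, FreeAlgebra.lift_ι_apply, map_zero] using hc⟩

theorem liftP_mkP (y : Idx → E) (hy : IsMomentum q y)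
    (hc : ∑ a : Idx, ∑ b : Idx, (metricDown q a b : ℂ) • (y a * y b) = 0)
    (w : FreeAlgebra ℂ Idx) : liftP y hy hc (mkP q w) = FreeAlgebra.lift ℂ y w :=
  RingQuot.liftAlgHom_mkAlgHom_apply ..

end Lift

theorem basisFreeMonoid_apply (w : FreeMonoid Idx) :
    FreeAlgebra.basisFreeMonoid ℂ Idx w = (w.toList.map (FreeAlgebra.ι ℂ)).prod := by
  simp only [FreeAlgebra.basisFreeMonoid, Module.Basis.map_apply, Finsupp.coe_basisSingleOne]
  change FreeAlgebra.equivMonoidAlgebraFreeMonoid.symm (MonoidAlgebra.single w 1) = _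
  simp [FreeAlgebra.equivMonoidAlgebraFreeMonoid, FreeMonoid.lift_apply]

/-! ### The braided derivatives -/

variable (q) in
/-- The operator `(f, ∂ f) ↦ (x_b f, ∂ (x_b f))` given by the braided Leibniz rule. -/
noncomputable def leibniz (b : Idx) : Module.End ℂ (Mq q × (Idx → Mq q)) where
  toFun f := (x q b * f.1, fun a => (if a = b then f.1 else 0) +
    ∑ c : Idx, ∑ d : Idx, (RL q c a b d : ℂ) • (x q c * f.2 d))
  map_add' f g := by
    refine Prod.ext (mul_add _ _ _) (funext fun a => ?_)
    simp only [Prod.fst_add, Prod.snd_add, Pi.add_apply, mul_add, smul_add,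
      Finset.sum_add_distrib]
    split_ifs <;> abel
  map_smul' r f := by
    refine Prod.ext (mul_smul_comm _ _ _) (funext fun a => ?_)
    simp only [Prod.smul_fst, Prod.smul_snd, Pi.smul_apply, mul_smul_comm, smul_add,
      Finset.smul_sum, smul_ite, smul_zero, smul_comm r, RingHom.id_apply]

theorem leibniz_apply (b : Idx) (f : Mq q × (Idx → Mq q)) :
    leibniz q b f = (x q b * f.1, fun a => (if a = b then f.1 else 0) +
      ∑ c : Idx, ∑ d : Idx, (RL q c a b d : ℂ) • (x q c * f.2 d)) := rfl

/-- Two Leibniz steps leave terms in f with coefficients 1 + B and terms in ∂f with coefficients B₁₂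
B₂₃. Each kind is matched with its own identity. -/
theorem leibniz_leibniz_snd (b e : Idx) (f : Mq q × (Idx → Mq q)) (a : Idx) :
    (leibniz q b (leibniz q e f)).2 a =
      (∑ c : Idx, ((1 + braid q) (a, c) (b, e) : ℂ) • (x q c * f.1)) +
      ∑ c : Idx, ∑ c' : Idx, ∑ d' : Idx,
        ((∑ d : Idx, RL q c a b d * RL q c' d e d' : ℝ) : ℂ) • (x q c * (x q c' * f.2 d')) := by
  simp only [leibniz_apply, mul_add, smul_add, Finset.sum_add_distrib, ← add_assoc]
  congr 1
  · simp only [Matrix.add_apply, Matrix.one_apply, Prod.mk.injEq, braid, Complex.ofReal_add,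
      add_smul, Finset.sum_add_distrib]
    congr 1
    have h : ∀ c, ((if a = b ∧ c = e then (1 : ℝ) else 0 : ℝ) : ℂ) • (x q c * f.1) =
        if c = e then (if a = b then x q e * f.1 else 0) else 0 := by
      intro c
      by_cases h1 : a = b <;> by_cases h2 : c = e <;> simp [h1, h2]
    simp only [h, Finset.sum_ite_eq', Finset.mem_univ, if_true]
    simp
  · refine Finset.sum_congr rfl fun c _ => ?_
    simp only [Complex.ofReal_sum, Complex.ofReal_mul, Finset.sum_smul, mul_smul, Finset.mul_sum,
      Finset.smul_sum, mul_smul_comm]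
    rw [Finset.sum_comm]
    refine Finset.sum_congr rfl fun c' _ => ?_
    rw [Finset.sum_comm]

/-- Reordering two coordinates moves M onto the coefficients, where the mixed braid relation
applies. -/
theorem sum_coordinate_mul (r : Idx → Idx → ℝ) (v : Mq q) :
    ∑ m : Idx, ∑ n : Idx, (r m n : ℂ) • (x q m * (x q n * v)) =
      ∑ c : Idx, ∑ c' : Idx, ((∑ m : Idx, ∑ n : Idx, RM q c' c m n * r m n : ℝ) : ℂ) •
        (x q c * (x q c' * v)) := by
  have h : ∀ m n, (r m n : ℂ) • (x q m * (x q n * v)) = ∑ c : Idx, ∑ c' : Idx,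
      ((RM q c' c m n * r m n : ℝ) : ℂ) • (x q c * (x q c' * v)) := by
    intro m n
    rw [← mul_assoc, isCoordinate_x q m n]
    simp only [Finset.sum_mul, Finset.smul_sum, smul_mul_assoc, smul_smul, mul_assoc,
      Complex.ofReal_mul]
    rw [Finset.sum_comm]
    simp only [mul_comm]
  simp only [h, Complex.ofReal_sum, Finset.sum_smul]
  have := Finset.sum_comm (s := (Finset.univ : Finset (Idx × Idx)))
    (t := (Finset.univ : Finset (Idx × Idx)))
    (f := fun y z => ((RM q z.2 z.1 y.1 y.2 * r y.1 y.2 : ℝ) : ℂ) • (x q z.1 * (x q z.2 * v)))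
  simpa only [Fintype.sum_prod_type] using this

theorem sum_relation_braid (hq : q ≠ 0) (a c c' b e d' : Idx) :
    ∑ m : Idx, ∑ n : Idx, RM q c' c m n * ∑ d : Idx, RL q m a b d * RL q n d e d' =
      ∑ g : Idx, ∑ h : Idx, RM q g h b e * ∑ d : Idx, RL q c a h d * RL q c' d g d' := by
  simp only [Finset.mul_sum]
  refine (mixed_braid_relation hq a c c' b e d').symm.trans (Eq.trans ?_ Finset.sum_comm)
  refine Finset.sum_congr rfl fun m _ => Eq.trans ?_ Finset.sum_comm
  exact Finset.sum_congr rfl fun n _ => Finset.sum_congr rfl fun k _ => by ring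

theorem sum_braid_braid_mul (hq : q ≠ 0) (b e : Idx) (v : Idx → Mq q) (a : Idx) :
    ∑ c : Idx, ∑ c' : Idx, ∑ d' : Idx,
        ((∑ d : Idx, RL q c a b d * RL q c' d e d' : ℝ) : ℂ) • (x q c * (x q c' * v d')) =
      ∑ g : Idx, ∑ h : Idx, (RM q g h b e : ℂ) • ∑ c : Idx, ∑ c' : Idx, ∑ d' : Idx,
        ((∑ d : Idx, RL q c a h d * RL q c' d g d' : ℝ) : ℂ) • (x q c * (x q c' * v d')) := by
  have h1 : ∀ F : Idx → Idx → Idx → Mq q,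
      ∑ c, ∑ c', ∑ d', F c c' d' = ∑ d', ∑ c, ∑ c', F c c' d' := fun F => by
    rw [Finset.sum_congr rfl fun c _ => Finset.sum_comm, Finset.sum_comm]
  have h2 : ∀ F : Idx → Idx → Idx → Idx → Mq q,
      ∑ g, ∑ h, ∑ c, ∑ c', F g h c c' = ∑ c, ∑ c', ∑ g, ∑ h, F g h c c' := fun F => by
    have := Finset.sum_comm (s := (Finset.univ : Finset (Idx × Idx)))
      (t := (Finset.univ : Finset (Idx × Idx))) (f := fun y z => F y.1 y.2 z.1 z.2)
    simpa only [Fintype.sum_prod_type] using this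
  calc _ = ∑ d', ∑ c, ∑ c', ((∑ d : Idx, RL q c a b d * RL q c' d e d' : ℝ) : ℂ) •
          (x q c * (x q c' * v d')) := h1 _
    _ = ∑ d', ∑ c, ∑ c', ((∑ g : Idx, ∑ h : Idx, RM q g h b e *
          ∑ d : Idx, RL q c a h d * RL q c' d g d' : ℝ) : ℂ) • (x q c * (x q c' * v d')) := by
        refine Finset.sum_congr rfl fun d' _ => ?_
        rw [sum_coordinate_mul fun c c' => ∑ d : Idx, RL q c a b d * RL q c' d e d']
        simp only [sum_relation_braid hq]
    _ = ∑ d', ∑ g, ∑ h, ∑ c, ∑ c', (RM q g h b e : ℂ) •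
          ((∑ d : Idx, RL q c a h d * RL q c' d g d' : ℝ) : ℂ) • (x q c * (x q c' * v d')) := by
        refine Finset.sum_congr rfl fun d' _ => ?_
        rw [h2]
        refine Finset.sum_congr rfl fun c _ => Finset.sum_congr rfl fun c' _ => ?_
        simp only [Complex.ofReal_sum (s := Finset.univ) (f := fun g => ∑ h : Idx, _),
          Complex.ofReal_sum (s := Finset.univ) (f := fun h => RM q _ h b e * _),
          Complex.ofReal_mul (RM q _ _ b e), Finset.sum_smul, mul_smul]
    _ = ∑ g, ∑ h, ∑ d', ∑ c, ∑ c', (RM q g h b e : ℂ) •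
          ((∑ d : Idx, RL q c a h d * RL q c' d g d' : ℝ) : ℂ) • (x q c * (x q c' * v d')) :=
        (h1 _).symm
    _ = _ := by
        refine Finset.sum_congr rfl fun g _ => Finset.sum_congr rfl fun h _ => ?_
        simp only [Finset.smul_sum]
        exact (h1 _).symm

/-- This is the consistency of the Leibniz rule with the relations of `Mq`: the operators define a
representation of `Mq` on pairs (f, ∂f). -/
theorem isCoordinate_leibniz (hq : q ≠ 0) : IsCoordinate q (leibniz q) := by
  intro b e
  refine LinearMap.ext fun f => Prod.ext ?_ (funext fun a => ?_)
  · simp only [Module.End.mul_apply, LinearMap.sum_apply, LinearMap.smul_apply, Prod.fst_sum,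
      Prod.smul_fst, leibniz_apply, ← mul_assoc]
    rw [isCoordinate_x q b e]
    simp only [Finset.sum_mul, smul_mul_assoc]
  · simp only [Module.End.mul_apply, LinearMap.sum_apply, LinearMap.smul_apply, Prod.snd_sum,
      Prod.smul_snd, Finset.sum_apply, Pi.smul_apply, leibniz_leibniz_snd, smul_add,
      Finset.sum_add_distrib]
    congr 1
    -- The terms in f agree because 1 + B absorbs M.
    · have h : (1 + braid q) = (1 + braid q) * relMat q := by
        have := one_add_braid_mul hq
        rwa [mul_sub, mul_one, sub_eq_zero] at this
      simp only [Finset.smul_sum]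
      rw [Finset.sum_congr rfl fun c _ => Finset.sum_comm, Finset.sum_comm]
      refine Finset.sum_congr rfl fun c _ => ?_
      conv_lhs => rw [h]
      rw [Matrix.mul_apply, Complex.ofReal_sum, Finset.sum_smul, Fintype.sum_prod_type,
        Finset.sum_comm]
      refine Finset.sum_congr rfl fun d _ => Finset.sum_congr rfl fun d' _ => ?_
      rw [relMat, smul_smul, mul_comm, Complex.ofReal_mul]
    · exact sum_braid_braid_mul hq b e f.2 a

end Generators

end QMinkowski

/-! ### Derivatives and stars on the quotient algebras -/

namespace QMinkowski

variable {q : ℝ}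

theorem linearMap_ext_words {N : Type*} [AddCommMonoid N] [Module ℂ N] {σ : ℂ →+* ℂ}
    {f g : FreeAlgebra ℂ Idx →ₛₗ[σ] N}
    (h : ∀ w : List Idx, f (w.map (FreeAlgebra.ι ℂ)).prod = g (w.map (FreeAlgebra.ι ℂ)).prod) :
    f = g := by
  refine (FreeAlgebra.basisFreeMonoid ℂ Idx).ext fun w => ?_
  rw [basisFreeMonoid_apply]
  exact h _

theorem freePartial_word (a : Idx) (w : List Idx) :
    freePartial q a (w.map (FreeAlgebra.ι ℂ)).prod = wordPartial q w a := by
  have h := basisFreeMonoid_apply (FreeMonoid.ofList w)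
  rw [FreeMonoid.toList_ofList] at h
  rw [← h, freePartial, Module.Basis.constr_basis, FreeMonoid.toList_ofList]

theorem mkM_word (w : List Idx) : mkM q (w.map (FreeAlgebra.ι ℂ)).prod = (w.map (x q)).prod := by
  rw [map_list_prod, List.map_map]
  rfl

/-- The orbit of (1, 0) records an element together with all its derivatives. As the action factors
through `Mq`, so do the derivatives. -/
theorem liftM_leibniz (hq : q ≠ 0) (w : FreeAlgebra ℂ Idx) :
    liftM (leibniz q) (isCoordinate_leibniz hq) (mkM q w) (1, 0) =
      (mkM q w, fun a => freePartial q a w) := by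
  have h : (LinearMap.applyₗ ((1, 0) : Mq q × (Idx → Mq q))) ∘ₗ
      (liftM (leibniz q) (isCoordinate_leibniz hq)).toLinearMap ∘ₗ (mkM q).toLinearMap =
      LinearMap.prod (mkM q).toLinearMap (LinearMap.pi fun a => freePartial q a) := by
    refine linearMap_ext_words fun w => ?_
    change liftM (leibniz q) (isCoordinate_leibniz hq) (mkM q _) (1, 0) =
      (mkM q _, fun a => freePartial q a _)
    simp only [freePartial_word]
    induction w with
    | nil =>
      rw [List.map_nil, List.prod_nil, map_one, map_one]
      rfl
    | cons b w ih =>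
      rw [List.map_cons, List.prod_cons, map_mul, map_mul, Module.End.mul_apply, ih, liftM_mkM,
        FreeAlgebra.lift_ι_apply, leibniz_apply, mkM_word]
      rfl
  exact LinearMap.congr_fun h w

theorem partialM_mkM (hq : q ≠ 0) (a : Idx) (w : FreeAlgebra ℂ Idx) :
    partialM q a (mkM q w) = freePartial q a w := by
  refine descend_apply (π := (mkM q).toLinearMap) ⟨LinearMap.proj a ∘ₗ LinearMap.snd ℂ _ _ ∘ₗ
    (LinearMap.applyₗ ((1, 0) : Mq q × (Idx → Mq q))) ∘ₗ
      (liftM (leibniz q) (isCoordinate_leibniz hq)).toLinearMap, fun w => ?_⟩ w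
  have h := liftM_leibniz hq w
  simp only [LinearMap.comp_apply, AlgHom.toLinearMap_apply, LinearMap.applyₗ_apply_apply, h,
    LinearMap.snd_apply, LinearMap.proj_apply]

theorem liftM_leibniz_apply (hq : q ≠ 0) (m : Mq q) :
    liftM (leibniz q) (isCoordinate_leibniz hq) m (1, 0) = (m, fun a => partialM q a m) := by
  obtain ⟨w, rfl⟩ := mkM_surjective q m
  rw [liftM_leibniz hq]
  simp only [partialM_mkM hq]

theorem partialM_one (hq : q ≠ 0) (a : Idx) : partialM q a 1 = 0 := by
  have h := liftM_leibniz_apply hq (1 : Mq q)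
  rw [map_one] at h
  exact (congrFun (congrArg Prod.snd h) a).symm

theorem partialM_x_mul (hq : q ≠ 0) (a b : Idx) (f : Mq q) :
    partialM q a (x q b * f) = (if a = b then f else 0) +
      ∑ c : Idx, ∑ d : Idx, (RL q c a b d : ℂ) • (x q c * partialM q d f) := by
  have h := liftM_leibniz_apply hq (x q b * f)
  have hx : liftM (leibniz q) (isCoordinate_leibniz hq) (x q b) = leibniz q b := by
    rw [x, liftM_mkM, FreeAlgebra.lift_ι_apply]
  rw [map_mul, Module.End.mul_apply, liftM_leibniz_apply hq, hx, leibniz_apply] at h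
  exact (congrFun (congrArg Prod.snd h) a).symm

/-! ### The star structures -/

theorem freeConj_word (w : List Idx) :
    freeConj (w.map (FreeAlgebra.ι ℂ)).prod =
      (w.map fun a => FreeAlgebra.ι ℂ (bar a)).reverse.prod := by
  have h := basisFreeMonoid_apply (FreeMonoid.ofList w)
  rw [FreeMonoid.toList_ofList] at h
  rw [← h]
  change ((FreeAlgebra.basisFreeMonoid ℂ Idx).repr _).sum (fun v c => conj c •
    ((v.toList.map fun a => FreeAlgebra.ι ℂ (bar a)).reverse.prod : FreeAlgebra ℂ Idx)) = _
  rw [Module.Basis.repr_self, Finsupp.sum_single_index (by simp), FreeMonoid.toList_ofList,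
    map_one, one_smul]

theorem freeConj_one : freeConj 1 = 1 := by
  simpa using freeConj_word []

theorem freeConj_ι (a : Idx) : freeConj (FreeAlgebra.ι ℂ a) = FreeAlgebra.ι ℂ (bar a) := by
  simpa using freeConj_word [a]

theorem freeConj_mul (v w : FreeAlgebra ℂ Idx) : freeConj (v * w) = freeConj w * freeConj v := by
  have hι : ∀ (a : Idx) (w : FreeAlgebra ℂ Idx),
      freeConj (FreeAlgebra.ι ℂ a * w) = freeConj w * FreeAlgebra.ι ℂ (bar a) := by
    intro a w
    have h : freeConj.comp (LinearMap.mulLeft ℂ (FreeAlgebra.ι ℂ a)) =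
        (LinearMap.mulRight ℂ (FreeAlgebra.ι ℂ (bar a))).comp freeConj := by
      refine linearMap_ext_words fun w => ?_
      have := freeConj_word (a :: w)
      simp only [List.map_cons, List.prod_cons, List.reverse_cons, List.prod_append] at this
      simp only [LinearMap.comp_apply, LinearMap.mulLeft_apply, LinearMap.mulRight_apply, this,
        freeConj_word, List.prod_nil, mul_one]
    exact LinearMap.congr_fun h w
  induction v using FreeAlgebra.induction generalizing w with
  | grade0 r =>
    rw [Algebra.algebraMap_eq_smul_one, smul_mul_assoc, one_mul, LinearMap.map_smulₛₗ,
      LinearMap.map_smulₛₗ, freeConj_one, mul_smul_comm, mul_one]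
  | grade1 a => rw [hι, freeConj_ι]
  | mul a b ha hb => rw [mul_assoc, ha, hb, ha, mul_assoc]
  | add a b ha hb => rw [add_mul, map_add, map_add, ha, hb, mul_add]

/-- An antimultiplicative map is a ring homomorphism into the opposite ring, so the universal
property of the ring quotient applies; conjugate linearity is recovered afterwards from
surjectivity. -/
theorem exists_conj {r : FreeAlgebra ℂ Idx → FreeAlgebra ℂ Idx → Prop}
    (h : ∀ v w, r v w → RingQuot.mkAlgHom ℂ r (freeConj v) = RingQuot.mkAlgHom ℂ r (freeConj w)) :
    ∃ ψ : RingQuot r →ₛₗ[starRingEnd ℂ] RingQuot r, ∀ w,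
      ψ (RingQuot.mkAlgHom ℂ r w) = RingQuot.mkAlgHom ℂ r (freeConj w) := by
  let φ : FreeAlgebra ℂ Idx →+* (RingQuot r)ᵐᵒᵖ :=
    { toFun := fun w => MulOpposite.op (RingQuot.mkAlgHom ℂ r (freeConj w))
      map_one' := by rw [freeConj_one, map_one, MulOpposite.op_one]
      map_mul' := fun v w => by rw [freeConj_mul, map_mul, MulOpposite.op_mul]
      map_zero' := by rw [map_zero, map_zero, MulOpposite.op_zero]
      map_add' := fun v w => by rw [map_add, map_add, MulOpposite.op_add] }
  let ψ := RingQuot.lift ⟨φ, fun v w hvw => congrArg MulOpposite.op (h v w hvw)⟩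
  have hψ : ∀ w, (ψ (RingQuot.mkAlgHom ℂ r w)).unop = RingQuot.mkAlgHom ℂ r (freeConj w) := by
    intro w
    have h1 : RingQuot.mkAlgHom ℂ r w = RingQuot.mkRingHom r w :=
      congrArg (fun f : _ →+* _ => f w) (RingQuot.mkAlgHom_coe ℂ r)
    rw [h1]
    exact congrArg MulOpposite.unop (RingQuot.lift_mkRingHom_apply φ _ w)
  refine ⟨{ toFun := fun m => (ψ m).unop
            map_add' := fun m n => by rw [map_add, MulOpposite.unop_add]
            map_smul' := fun c m => ?_ }, hψ⟩
  obtain ⟨w, rfl⟩ := RingQuot.mkAlgHom_surjective ℂ r m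
  rw [← map_smul, hψ, hψ, LinearMap.map_smulₛₗ, map_smul]

theorem relMat_mul_bar (hq : q ≠ 0) :
    relMat q * (relMat q).submatrix barSwap barSwap = 1 :=
  mul_eq_one_comm.1 (relMat_bar_mul hq)

section Bar

variable {E : Type*} [Semiring E] [Algebra ℂ E]

/-- The involution `barSwap` as a permutation. -/
def barEquiv : Idx × Idx ≃ Idx × Idx := ⟨barSwap, barSwap, barSwap_barSwap, barSwap_barSwap⟩

/-- A row fixed by M is fixed by M⁻¹, which is M with barred and swapped indices. The result is the
star of the relation. -/
theorem IsCoordinate.bar (hq : q ≠ 0) {y : Idx → E} (hy : IsCoordinate q y) (a b : Idx) :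
    y (bar b) * y (bar a) =
      ∑ c : Idx, ∑ d : Idx, (RM q c d a b : ℂ) • (y (bar c) * y (bar d)) := by
  have h := (isCoordinate_iff y).1 hy
  have h2 : Matrix.vecMul (pairProd y) (scalarMatrix E ((relMat q).submatrix barSwap barSwap)) =
      pairProd y := by
    conv_lhs => rw [← h]
    rw [Matrix.vecMul_vecMul, ← map_mul, relMat_mul_bar hq, map_one, Matrix.vecMul_one]
  have h3 := congrFun h2 (barSwap (a, b))
  simp only [Matrix.vecMul, dotProduct, scalarMatrix_apply, Matrix.submatrix_apply,
    barSwap_barSwap, mul_realScalar] at h3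
  rw [← Equiv.sum_comp barEquiv] at h3
  simp only [barEquiv, Equiv.coe_fn_mk, barSwap_barSwap, Fintype.sum_prod_type] at h3
  rw [Finset.sum_comm] at h3
  exact h3.symm

theorem IsMomentum.bar (hq : q ≠ 0) {y : Idx → E} (hy : IsMomentum q y) (a b : Idx) :
    y (bar b) * y (bar a) =
      ∑ c : Idx, ∑ d : Idx, (RM q a b c d : ℂ) • (y (bar c) * y (bar d)) := by
  have h := (isMomentum_iff y).1 hy
  have h2 : (scalarMatrix E ((relMat q).submatrix barSwap barSwap)).mulVec
      (fun i => y i.2 * y i.1) = fun i => y i.2 * y i.1 := by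
    conv_lhs => rw [← h]
    rw [Matrix.mulVec_mulVec, ← map_mul, relMat_bar_mul hq, map_one, Matrix.one_mulVec]
  have h3 := congrFun h2 (barSwap (b, a))
  simp only [Matrix.mulVec, dotProduct, scalarMatrix_apply, Matrix.submatrix_apply,
    barSwap_barSwap, realScalar_mul] at h3
  rw [← Equiv.sum_comp barEquiv] at h3
  simp only [barEquiv, Equiv.coe_fn_mk, barSwap_barSwap, Fintype.sum_prod_type] at h3
  exact h3.symm

end Bar

theorem conjM_mkM (hq : q ≠ 0) (w : FreeAlgebra ℂ Idx) :
    conjM q (mkM q w) = mkM q (freeConj w) := by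
  refine descend_apply (π := (mkM q).toLinearMap) (exists_conj ?_) w
  rintro _ _ ⟨a, b⟩
  simp only [map_sum, LinearMap.map_smulₛₗ, freeConj_mul, freeConj_ι, map_mul, map_smul,
    Complex.conj_ofReal]
  exact (isCoordinate_x q).bar hq a b

theorem conjP_mkP (hq : 0 < q) (w : FreeAlgebra ℂ Idx) :
    conjP q (mkP q w) = mkP q (freeConj w) := by
  refine descend_apply (π := (mkP q).toLinearMap) (exists_conj ?_) w
  rintro _ _ (⟨a, b⟩ | _)
  · simp only [map_sum, LinearMap.map_smulₛₗ, freeConj_mul, freeConj_ι, map_mul, map_smul,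
      Complex.conj_ofReal]
    exact (isMomentum_p q).bar hq.ne' a b
  · simp only [map_sum, LinearMap.map_smulₛₗ, freeConj_mul, freeConj_ι, map_mul, map_smul,
      Complex.conj_ofReal, map_zero]
    -- Barring both summation indices and using g_{ā b̄} = g_{ba} turns the reversed cone relation
    -- into the original one.
    have h := cone_p q
    rw [← (Equiv.mk bar bar bar_bar bar_bar).sum_comp, Finset.sum_congr (s₁ := Finset.univ) rfl fun a _ =>
      ((Equiv.mk bar bar bar_bar bar_bar).sum_comp _).symm, Finset.sum_comm] at h
    simp only [Equiv.coe_fn_mk, metricDown_bar hq] at h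
    exact h

theorem conjM_mul (hq : q ≠ 0) (m n : Mq q) : conjM q (m * n) = conjM q n * conjM q m := by
  obtain ⟨v, rfl⟩ := mkM_surjective q m
  obtain ⟨w, rfl⟩ := mkM_surjective q n
  simp only [← map_mul, conjM_mkM hq, freeConj_mul]

theorem conjP_mul (hq : 0 < q) (m n : P0 q) : conjP q (m * n) = conjP q n * conjP q m := by
  obtain ⟨v, rfl⟩ := mkP_surjective q m
  obtain ⟨w, rfl⟩ := mkP_surjective q n
  simp only [← map_mul, conjP_mkP hq, freeConj_mul]

theorem conjM_x (hq : q ≠ 0) (a : Idx) : conjM q (x q a) = x q (bar a) := by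
  rw [x, conjM_mkM hq, freeConj_ι]
  rfl

theorem conjP_p (hq : 0 < q) (a : Idx) : conjP q (p q a) = p q (bar a) := by
  rw [p, conjP_mkP hq, freeConj_ι]
  rfl

theorem conjM_one (hq : q ≠ 0) : conjM q 1 = 1 := by
  rw [← map_one (mkM q), conjM_mkM hq, freeConj_one]

theorem conjP_one (hq : 0 < q) : conjP q 1 = 1 := by
  rw [← map_one (mkP q), conjP_mkP hq, freeConj_one]

end QMinkowski

/-! ### Coactions of the extended quantum Lorentz group -/

namespace QMinkowski

variable {q : ℝ}

/-! ### The coactions -/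

section Lorentz

variable {E F : Type*} [Semiring E] [Algebra ℂ E] [Semiring F] [Algebra ℂ F]

theorem IsLorentz.map {l : Idx → Idx → E} (hl : IsLorentz q l) (φ : E →ₐ[ℂ] F) :
    IsLorentz q fun a b => φ (l a b) := by
  intro a b c d
  simpa only [map_sum, map_smul, map_mul] using congrArg φ (hl a b c d)

/-- Elements of an algebra which satisfy the metric relation of the quantum Lorentz group, up to a
factor. -/
def IsMetric (q : ℝ) (l : Idx → Idx → E) (s : E) : Prop :=
  ∀ a b, ∑ c : Idx, ∑ d : Idx, (metricUp q c d : ℂ) • (l a c * l b d) = (metricUp q a b : ℂ) • s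

theorem IsMetric.map {l : Idx → Idx → E} {s : E} (hl : IsMetric q l s) (φ : E →ₐ[ℂ] F) :
    IsMetric q (fun a b => φ (l a b)) (φ s) := by
  intro a b
  simpa only [map_sum, map_smul, map_mul] using congrArg φ (hl a b)

theorem mul_central_mul {E : Type*} [Semiring E] {s : E} (hs : ∀ z, Commute s z) (z w : E) :
    z * s * (w * s) = z * w * (s * s) := by
  rw [mul_assoc, ← mul_assoc s w, (hs w).eq, mul_assoc w, mul_assoc]

theorem IsMetric.mul_central {l : Idx → Idx → E} {s t : E} (hl : IsMetric q l s)
    (ht : ∀ z, Commute t z) : IsMetric q (fun a b => l a b * t) (s * (t * t)) := by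
  intro a b
  simpa only [mul_central_mul ht, ← smul_mul_assoc, ← Finset.sum_mul] using
    congrArg (· * (t * t)) (hl a b)

theorem IsLorentz.mul_central {l : Idx → Idx → E} (hl : IsLorentz q l) {s : E}
    (hs : ∀ z, Commute s z) : IsLorentz q fun a b => l a b * s := by
  intro a b c d
  simpa only [mul_central_mul hs, ← smul_mul_assoc, ← Finset.sum_mul] using congrArg (· * (s * s)) (hl a b c d)

end Lorentz

section Map

variable {E F : Type*} [Semiring E] [Algebra ℂ E] [Semiring F] [Algebra ℂ F]

theorem IsCoordinate.map {y : Idx → E} (hy : IsCoordinate q y) (φ : E →ₐ[ℂ] F) :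
    IsCoordinate q fun a => φ (y a) := by
  intro a b
  simpa only [map_sum, map_smul, map_mul] using congrArg φ (hy a b)

theorem IsMomentum.map {y : Idx → E} (hy : IsMomentum q y) (φ : E →ₐ[ℂ] F) :
    IsMomentum q fun a => φ (y a) := by
  intro a b
  simpa only [map_sum, map_smul, map_mul] using congrArg φ (hy a b)

end Map

/-- The inclusion of the quantum Lorentz group into its extension. -/
noncomputable def constAlg (q : ℝ) : Lq q →ₐ[ℂ] LqExt q :=
  { LaurentPolynomial.C with commutes' := fun r => (LaurentPolynomial.algebraMap_apply r).symm }

theorem constAlg_apply (z : Lq q) : constAlg q z = LaurentPolynomial.C z := rfl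

/-- The generators of the quantum Lorentz group, multiplied by a power of the dilaton. -/
noncomputable def lamExt (q : ℝ) (k : ℤ) (a b : Idx) : LqExt q :=
  constAlg q (lam q a b) * LaurentPolynomial.T k

theorem commute_T (k : ℤ) (z : LqExt q) : Commute (LaurentPolynomial.T k : LqExt q) z :=
  LaurentPolynomial.commute_T k z

theorem isLorentz_lamExt (k : ℤ) : IsLorentz q (lamExt q k) :=
  ((isLorentz_lam q).map (constAlg q)).mul_central (commute_T k)

theorem isMetric_lam (q : ℝ) : IsMetric q (lam q) 1 := by
  intro a b
  rw [lam_metric, Algebra.algebraMap_eq_smul_one]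

theorem isMetric_lamExt (k : ℤ) : IsMetric q (lamExt q k)
    (constAlg q 1 * (LaurentPolynomial.T k * LaurentPolynomial.T k)) :=
  ((isMetric_lam q).map (constAlg q)).mul_central (commute_T k)

section Momentum

variable {E : Type*} [Semiring E] [Algebra ℂ E]

theorem sum_metricUp_metricDown (hq : 0 < q) (y : Idx → E) (c : Idx) :
    ∑ e : Idx, (metricUp q c e : ℂ) • (∑ b : Idx, (metricDown q b e : ℂ) • y b) = y c := by
  simp only [Finset.smul_sum, smul_smul, ← Complex.ofReal_mul]
  rw [Finset.sum_comm]
  simp only [← Finset.sum_smul, ← Complex.ofReal_sum, metricUp_mul hq]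
  simp [apply_ite Complex.ofReal, ite_smul]

theorem sum_metricDown_metricUp (hq : 0 < q) (z : Idx → E) (b : Idx) :
    ∑ a : Idx, (metricDown q a b : ℂ) • (∑ c : Idx, (metricUp q a c : ℂ) • z c) = z b := by
  simp only [Finset.smul_sum, smul_smul, ← Complex.ofReal_mul]
  rw [Finset.sum_comm]
  simp only [← Finset.sum_smul, ← Complex.ofReal_sum, metricDown_transpose_mul hq]
  simp [apply_ite Complex.ofReal, ite_smul]

theorem sum_metricUp_lower (hq : 0 < q) (y : Idx → E) :
    ∑ c : Idx, ∑ e : Idx, (metricUp q c e : ℂ) •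
      ((∑ a : Idx, (metricDown q a c : ℂ) • y a) * ∑ b : Idx, (metricDown q b e : ℂ) • y b) =
      ∑ a : Idx, ∑ b : Idx, (metricDown q a b : ℂ) • (y a * y b) := by
  have h : ∀ c, ∑ e : Idx, (metricUp q c e : ℂ) • ((∑ a : Idx, (metricDown q a c : ℂ) • y a) *
      ∑ b : Idx, (metricDown q b e : ℂ) • y b) = (∑ a : Idx, (metricDown q a c : ℂ) • y a) * y c :=
    fun c => by
      conv_rhs => rw [← sum_metricUp_metricDown hq y c, Finset.mul_sum]
      exact Finset.sum_congr rfl fun e _ => (mul_smul_comm _ _ _).symm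
  rw [Finset.sum_congr rfl fun c _ => h c]
  simp only [Finset.sum_mul, smul_mul_assoc]
  exact Finset.sum_comm

theorem sum_metricDown_raise (hq : 0 < q) (z : Idx → E) :
    ∑ a : Idx, ∑ b : Idx, (metricDown q a b : ℂ) •
      ((∑ c : Idx, (metricUp q a c : ℂ) • z c) * ∑ d : Idx, (metricUp q b d : ℂ) • z d) =
      ∑ b : Idx, ∑ d : Idx, (metricUp q b d : ℂ) • (z b * z d) := by
  have h : ∀ b, ∑ a : Idx, (metricDown q a b : ℂ) • ((∑ c : Idx, (metricUp q a c : ℂ) • z c) *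
      ∑ d : Idx, (metricUp q b d : ℂ) • z d) = z b * ∑ d : Idx, (metricUp q b d : ℂ) • z d :=
    fun b => by
      conv_rhs => rw [← sum_metricDown_metricUp hq z b, Finset.sum_mul]
      exact Finset.sum_congr rfl fun e _ => (smul_mul_assoc _ _ _).symm
  rw [Finset.sum_comm, Finset.sum_congr rfl fun c _ => h c]
  simp only [Finset.mul_sum, mul_smul_comm]

/-- The y's move past the l's, and the metric relation then contracts the l's to the factor s; so
the norm is an invariant up to s. -/
theorem sum_metricUp_transform {y : Idx → E} {l : Idx → Idx → E}
    (hc : ∀ a b c, Commute (y a) (l b c)) {s : E} (hl : IsMetric q l s) :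
    ∑ b : Idx, ∑ d : Idx, (metricUp q b d : ℂ) • ((∑ c, y c * l c b) * ∑ e, y e * l e d) =
      (∑ c : Idx, ∑ e : Idx, (metricUp q c e : ℂ) • (y c * y e)) * s := by
  have h : ∀ b d c e, (metricUp q b d : ℂ) • (y c * l c b * (y e * l e d)) =
      y c * y e * ((metricUp q b d : ℂ) • (l c b * l e d)) := by
    intro b d c e
    rw [mul_assoc, mul_assoc, ← mul_assoc (l c b), ← (hc e c b).eq, mul_assoc (y e),
      mul_smul_comm, mul_smul_comm]
  simp only [Finset.sum_mul_sum, Finset.smul_sum, h]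
  have h2 := Finset.sum_comm (s := (Finset.univ : Finset (Idx × Idx)))
    (t := (Finset.univ : Finset (Idx × Idx)))
    (f := fun i j => y j.1 * y j.2 * ((metricUp q i.1 i.2 : ℂ) • (l j.1 i.1 * l j.2 i.2)))
  simp only [Fintype.sum_prod_type] at h2
  rw [h2]
  simp only [← Finset.mul_sum, Finset.sum_mul]
  refine Finset.sum_congr rfl fun c _ => Finset.sum_congr rfl fun e _ => ?_
  rw [hl c e, mul_smul_comm, smul_mul_assoc]

/-- The antipode on elements which satisfy the relations of the quantum Lorentz group. -/
noncomputable def antipode (q : ℝ) (l : Idx → Idx → E) (a b : Idx) : E :=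
  ∑ c : Idx, ∑ d : Idx, ((metricUp q a c * metricDown q b d : ℝ) : ℂ) • l d c

/-- The antipode carries one metric on each side: lower the index, transform as a coordinate, raise
again. All properties of the momentum coaction follow from this factorisation. -/
theorem sum_mul_antipode (y : Idx → E) (l : Idx → Idx → E) (a : Idx) :
    ∑ b, y b * antipode q l a b = ∑ c : Idx, (metricUp q a c : ℂ) •
      ∑ d, (∑ b, (metricDown q b d : ℂ) • y b) * l d c := by
  simp only [antipode, Finset.mul_sum, Finset.sum_mul, Finset.smul_sum, Complex.ofReal_mul,
    mul_smul, mul_smul_comm, smul_mul_assoc]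
  rw [Finset.sum_comm]
  exact Finset.sum_congr rfl fun c _ => Finset.sum_comm

theorem commute_lower {y : Idx → E} {l : Idx → Idx → E} (hc : ∀ a b c, Commute (y a) (l b c))
    (a b c : Idx) : Commute (∑ d : Idx, (metricDown q d a : ℂ) • y d) (l b c) :=
  Commute.sum_left _ _ _ fun d _ => (hc d b c).smul_left _

theorem IsMomentum.transform (hq : 0 < q) {y : Idx → E} (hy : IsMomentum q y)
    {l : Idx → Idx → E} (hl : IsLorentz q l) (hc : ∀ a b c, Commute (y a) (l b c)) :
    IsMomentum q fun a => ∑ b, y b * antipode q l a b := by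
  simp only [sum_mul_antipode]
  exact ((hy.lower hq).transform hq.ne' hl (commute_lower hc)).raise hq

theorem cone_transform (hq : 0 < q) {y : Idx → E} {l : Idx → Idx → E} {s : E}
    (hy : ∑ a : Idx, ∑ b : Idx, (metricDown q a b : ℂ) • (y a * y b) = 0)
    (hl : IsMetric q l s) (hc : ∀ a b c, Commute (y a) (l b c)) :
    ∑ a : Idx, ∑ b : Idx, (metricDown q a b : ℂ) •
      ((∑ c, y c * antipode q l a c) * ∑ c, y c * antipode q l b c) = 0 := by
  simp only [sum_mul_antipode]
  rw [sum_metricDown_raise hq, sum_metricUp_transform (commute_lower hc) hl,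
    sum_metricUp_lower hq, hy, zero_mul]

/-- The metric relation collapses the two generators to g^{bd} s, and the remaining lower metric
inverts g^{bd}. -/
theorem sum_mul_antipode_self (hq : 0 < q) {l : Idx → Idx → E} {s : E} (hl : IsMetric q l s)
    (b c : Idx) : ∑ a, l b a * antipode q l a c = if b = c then s else 0 := by
  have h : ∑ a, l b a * antipode q l a c = ∑ d : Idx, (metricDown q c d : ℂ) •
      ∑ a : Idx, ∑ c' : Idx, (metricUp q a c' : ℂ) • (l b a * l d c') := by
    simp only [antipode, Finset.mul_sum, Finset.smul_sum, mul_smul_comm, smul_smul,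
      ← Complex.ofReal_mul]
    rw [Finset.sum_congr rfl fun a _ => Finset.sum_comm, Finset.sum_comm]
    simp only [mul_comm]
  rw [h, Finset.sum_congr rfl fun d _ => by rw [hl b d]]
  simp only [smul_smul, ← Complex.ofReal_mul, ← Finset.sum_smul, ← Complex.ofReal_sum]
  rw [Finset.sum_congr rfl fun d _ => mul_comm _ _, metricUp_mul hq]
  split_ifs <;> simp

end Momentum

section Tensor

variable {A B : Type*} [Semiring A] [Algebra ℂ A] [Semiring B] [Algebra ℂ B]

theorem commute_tmul (a : A) (b : B) : Commute (a ⊗ₜ[ℂ] (1 : B)) ((1 : A) ⊗ₜ[ℂ] b) := by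
  simp only [Commute, SemiconjBy, Algebra.TensorProduct.tmul_mul_tmul, one_mul, mul_one]

theorem IsLorentz.tmul {l : Idx → Idx → B} (hl : IsLorentz q l) :
    IsLorentz q fun a b => (1 : A) ⊗ₜ[ℂ] l a b :=
  hl.map (Algebra.TensorProduct.includeRight : B →ₐ[ℂ] A ⊗[ℂ] B)

theorem IsMetric.tmul {l : Idx → Idx → B} {s : B} (hl : IsMetric q l s) :
    IsMetric q (fun a b => (1 : A) ⊗ₜ[ℂ] l a b) ((1 : A) ⊗ₜ[ℂ] s) :=
  hl.map (Algebra.TensorProduct.includeRight : B →ₐ[ℂ] A ⊗[ℂ] B)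

theorem IsCoordinate.coact (hq : q ≠ 0) {y : Idx → A} (hy : IsCoordinate q y)
    {l : Idx → Idx → B} (hl : IsLorentz q l) :
    IsCoordinate q fun a => ∑ b, y b ⊗ₜ[ℂ] l b a := by
  have h := (hy.map (Algebra.TensorProduct.includeLeft : A →ₐ[ℂ] A ⊗[ℂ] B)).transform hq
    (hl.tmul (A := A)) fun a b c => commute_tmul _ _
  simpa only [Algebra.TensorProduct.includeLeft_apply, Algebra.TensorProduct.tmul_mul_tmul,
    one_mul, mul_one] using h

theorem antipode_tmul (l : Idx → Idx → B) (a b : Idx) :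
    antipode q (fun a b => (1 : A) ⊗ₜ[ℂ] l a b) a b = 1 ⊗ₜ[ℂ] antipode q l a b := by
  simp only [antipode, TensorProduct.tmul_sum, TensorProduct.tmul_smul]

theorem IsMomentum.coact (hq : 0 < q) {y : Idx → A} (hy : IsMomentum q y)
    {l : Idx → Idx → B} (hl : IsLorentz q l) :
    IsMomentum q fun a => ∑ b, y b ⊗ₜ[ℂ] antipode q l a b := by
  have h := (hy.map (Algebra.TensorProduct.includeLeft : A →ₐ[ℂ] A ⊗[ℂ] B)).transform hq
    (hl.tmul (A := A)) fun a b c => commute_tmul _ _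
  simpa only [Algebra.TensorProduct.includeLeft_apply, Algebra.TensorProduct.tmul_mul_tmul,
    one_mul, mul_one, antipode_tmul] using h

theorem cone_coact (hq : 0 < q) {y : Idx → A}
    (hy : ∑ a : Idx, ∑ b : Idx, (metricDown q a b : ℂ) • (y a * y b) = 0)
    {l : Idx → Idx → B} {s : B} (hl : IsMetric q l s) :
    ∑ a : Idx, ∑ b : Idx, (metricDown q a b : ℂ) •
      ((∑ c, y c ⊗ₜ[ℂ] antipode q l a c) * ∑ c, y c ⊗ₜ[ℂ] antipode q l b c) = 0 := by
  have h0 := congrArg (Algebra.TensorProduct.includeLeft : A →ₐ[ℂ] A ⊗[ℂ] B) hy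
  simp only [map_sum, map_smul, map_mul, map_zero] at h0
  have h := cone_transform hq h0 (hl.tmul (A := A)) fun a b c => commute_tmul _ _
  simpa only [Algebra.TensorProduct.includeLeft_apply, Algebra.TensorProduct.tmul_mul_tmul,
    one_mul, mul_one, antipode_tmul] using h

end Tensor

theorem antipode_lamExt (k : ℤ) (a b : Idx) : antipode q (lamExt q k) a b =
    LaurentPolynomial.C (antipodeLam q a b) * LaurentPolynomial.T k := by
  rw [← constAlg_apply]
  simp only [antipode, antipodeLam, lamExt, map_sum, map_smul, Finset.sum_mul, smul_mul_assoc]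

theorem coactM_mkM (hq : q ≠ 0) (w : FreeAlgebra ℂ Idx) :
    coactM q (mkM q w) = freeCoactM q w := by
  have h := (isCoordinate_x q).coact hq (isLorentz_lamExt (q := q) 1)
  refine descend_apply (π := (mkM q).toLinearMap) ⟨(liftM _ h).toLinearMap, fun w => ?_⟩ w
  exact liftM_mkM _ h w

theorem coactP_mkP (hq : 0 < q) (w : FreeAlgebra ℂ Idx) :
    coactP q (mkP q w) = freeCoactP q w := by
  have h := (isMomentum_p q).coact hq (isLorentz_lamExt (q := q) (-1))
  have hc := cone_coact hq (cone_p q) (isMetric_lamExt (q := q) (-1))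
  refine descend_apply (π := (mkP q).toLinearMap) ⟨(liftP _ h hc).toLinearMap, fun w => ?_⟩ w
  refine (liftP_mkP _ h hc w).trans ?_
  simp only [antipode_lamExt]
  rfl

theorem coactM_x_mul (hq : q ≠ 0) (a : Idx) (m : Mq q) :
    coactM q (x q a * m) = (∑ b : Idx, x q b ⊗ₜ[ℂ] lamExt q 1 b a) * coactM q m := by
  obtain ⟨w, rfl⟩ := mkM_surjective q m
  rw [x, ← map_mul, coactM_mkM hq, coactM_mkM hq, map_mul]
  congr 1
  exact FreeAlgebra.lift_ι_apply _ _

theorem coactP_mul_p (hq : 0 < q) (a : Idx) (f : P0 q) :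
    coactP q (f * p q a) =
      coactP q f * ∑ b : Idx, p q b ⊗ₜ[ℂ] antipode q (lamExt q (-1)) a b := by
  obtain ⟨w, rfl⟩ := mkP_surjective q f
  rw [p, ← map_mul, coactP_mkP hq, coactP_mkP hq, map_mul]
  congr 1
  simp only [antipode_lamExt]
  exact FreeAlgebra.lift_ι_apply _ _

theorem coactM_one (hq : q ≠ 0) : coactM q 1 = 1 := by
  rw [← map_one (mkM q), coactM_mkM hq, map_one]

theorem coactP_one (hq : 0 < q) : coactP q 1 = 1 := by
  rw [← map_one (mkP q), coactP_mkP hq, map_one]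

theorem wellDefined (hq : 0 < q) : WellDefined q where
  partialM_mk := partialM_mkM hq.ne'
  conjM_mk := conjM_mkM hq.ne'
  conjP_mk := conjP_mkP hq
  coactM_mk := coactM_mkM hq.ne'
  coactP_mk := coactP_mkP hq

end QMinkowski

/-! ### The nested pairing of coordinates and momenta -/

namespace QMinkowski

variable {q : ℝ}

/-! ### The homogeneous components of the exponentials -/

/-- The tensor `x_{a₁} ⋯ x_{aₙ} ⊗ p^{aₙ} ⋯ p^{a₁}`. -/
noncomputable def pairing (q : ℝ) : ℕ → Mq q ⊗[ℂ] P0 q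
  | 0 => 1
  | n + 1 => ∑ b : Idx, (x q b ⊗ₜ[ℂ] 1) * pairing q n * (1 ⊗ₜ[ℂ] p q b)

theorem sum_words_eq_pairing (n : ℕ) : ∑ a : Fin n → Idx,
    (List.ofFn fun i => x q (a i)).prod ⊗ₜ[ℂ] (List.ofFn fun i => p q (a i)).reverse.prod =
      pairing q n := by
  induction n with
  | zero => simp [pairing, Algebra.TensorProduct.one_def]
  | succ n ih =>
    rw [sum_fin_succ_fun, pairing]
    refine Finset.sum_congr rfl fun b _ => ?_
    rw [← ih, Finset.mul_sum, Finset.sum_mul]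
    refine Finset.sum_congr rfl fun a _ => ?_
    simp only [List.ofFn_succ, Fin.cons_zero, Fin.cons_succ, List.prod_cons, List.reverse_cons,
      List.prod_append, List.prod_nil, mul_one, Algebra.TensorProduct.tmul_mul_tmul, one_mul]

theorem qExp_eq (t : ℝ) (z : ℂ) (n : ℕ) :
    qExp q t z n = (z ^ n / (qFactorial t n : ℂ)) • pairing q n := by
  rw [qExp, sum_words_eq_pairing]

theorem rTensor_partialM_x_mul (hq : q ≠ 0) (a b : Idx) (t : Mq q ⊗[ℂ] P0 q) :
    (partialM q a).rTensor (P0 q) ((x q b ⊗ₜ[ℂ] 1) * t) = (if a = b then t else 0) +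
      ∑ c : Idx, ∑ d : Idx, (RL q c a b d : ℂ) •
        ((x q c ⊗ₜ[ℂ] 1) * (partialM q d).rTensor (P0 q) t) := by
  induction t with
  | zero => simp
  | tmul m f =>
    simp only [Algebra.TensorProduct.tmul_mul_tmul, one_mul, LinearMap.rTensor_tmul,
      partialM_x_mul hq, TensorProduct.add_tmul, TensorProduct.sum_tmul, TensorProduct.smul_tmul',
      TensorProduct.ite_tmul]
  | add s t hs ht =>
    simp only [mul_add, map_add, hs, ht, smul_add, Finset.sum_add_distrib]
    split_ifs <;> abel

theorem rTensor_mul_p (φ : Mq q →ₗ[ℂ] Mq q) (b : Idx) (t : Mq q ⊗[ℂ] P0 q) :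
    φ.rTensor (P0 q) (t * (1 ⊗ₜ[ℂ] p q b)) = φ.rTensor (P0 q) t * (1 ⊗ₜ[ℂ] p q b) := by
  induction t with
  | zero => simp
  | tmul m f =>
    simp only [Algebra.TensorProduct.tmul_mul_tmul, mul_one, LinearMap.rTensor_tmul]
  | add s t hs ht => simp only [add_mul, map_add, hs, ht]

theorem lTensor_mulRight (a : Idx) (t : Mq q ⊗[ℂ] P0 q) :
    (LinearMap.mulRight ℂ (p q a)).lTensor (Mq q) t = t * (1 ⊗ₜ[ℂ] p q a) := by
  induction t with
  | zero => simp
  | tmul m f =>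
    simp only [Algebra.TensorProduct.tmul_mul_tmul, mul_one, LinearMap.lTensor_tmul,
      LinearMap.mulRight_apply]
  | add s t hs ht => simp only [add_mul, map_add, hs, ht]

theorem partialM_pairing_zero (hq : q ≠ 0) (a : Idx) :
    (partialM q a).rTensor (P0 q) (pairing q 0) = 0 := by
  rw [pairing, Algebra.TensorProduct.one_def, LinearMap.rTensor_tmul, partialM_one hq,
    TensorProduct.zero_tmul]

/-- The Leibniz rule removes the outermost coordinate or passes it. In the second case the inductive
derivative puts p^d next to the outer p^b, and R_L acting on p^d p^b is q² on the cone, which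
rebuilds the pairing followed by p^a. -/
theorem partialM_pairing_succ (hq : 0 < q) (n : ℕ) (a : Idx) :
    (partialM q a).rTensor (P0 q) (pairing q (n + 1)) =
      ((∑ k ∈ Finset.range (n + 1), (q ^ 2) ^ k : ℝ) : ℂ) •
        (pairing q n * (1 ⊗ₜ[ℂ] p q a)) := by
  have hstep : ∀ (a : Idx) (n : ℕ), (partialM q a).rTensor (P0 q) (pairing q (n + 1)) =
      pairing q n * (1 ⊗ₜ[ℂ] p q a) + ∑ c : Idx, ∑ b : Idx, ∑ d : Idx, (RL q c a b d : ℂ) •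
        ((x q c ⊗ₜ[ℂ] 1) * (partialM q d).rTensor (P0 q) (pairing q n) *
          (1 ⊗ₜ[ℂ] p q b)) := by
    intro a n
    rw [pairing, map_sum]
    simp only [rTensor_mul_p, rTensor_partialM_x_mul hq.ne', add_mul, ite_mul, zero_mul,
      Finset.sum_add_distrib, Finset.sum_ite_eq, Finset.mem_univ, if_true, Finset.sum_mul,
      smul_mul_assoc]
    rw [Finset.sum_comm]
  induction n generalizing a with
  | zero => simp [hstep, partialM_pairing_zero hq.ne']
  | succ n ih =>
    have hc : ∀ c, ∑ b : Idx, ∑ d : Idx, (RL q c a b d : ℂ) •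
        ((x q c ⊗ₜ[ℂ] 1) * (partialM q d).rTensor (P0 q) (pairing q (n + 1)) *
          (1 ⊗ₜ[ℂ] p q b)) =
        ((∑ k ∈ Finset.range (n + 1), (q ^ 2) ^ k * q ^ 2 : ℝ) : ℂ) •
          ((x q c ⊗ₜ[ℂ] 1) * pairing q n * (1 ⊗ₜ[ℂ] p q c) * (1 ⊗ₜ[ℂ] p q a)) := by
      intro c
      have hp : ∑ b : Idx, ∑ d : Idx, (RL q c a b d : ℂ) • ((1 : Mq q) ⊗ₜ[ℂ] (p q d * p q b)) =
          ((q ^ 2 : ℝ) : ℂ) • ((1 : Mq q) ⊗ₜ[ℂ] (p q c * p q a)) := by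
        simp only [← TensorProduct.tmul_smul, ← TensorProduct.tmul_sum,
          (isMomentum_p q).braid_mul hq (cone_p q) a c]
      have h := congrArg (fun t => ((∑ k ∈ Finset.range (n + 1), (q ^ 2) ^ k : ℝ) : ℂ) •
        ((x q c ⊗ₜ[ℂ] 1) * pairing q n * t)) hp
      have hm : ∀ d b, ((1 : Mq q) ⊗ₜ[ℂ] (p q d * p q b)) =
          ((1 : Mq q) ⊗ₜ[ℂ] p q d) * ((1 : Mq q) ⊗ₜ[ℂ] p q b) := fun d b => by
        rw [Algebra.TensorProduct.tmul_mul_tmul, one_mul]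
      simp only [Finset.mul_sum, Finset.smul_sum, mul_smul_comm, smul_smul, hm, ← mul_assoc] at h
      simp only [ih, mul_smul_comm, smul_mul_assoc, smul_smul, ← mul_assoc]
      rw [← Finset.sum_mul, Complex.ofReal_mul, ← h]
      exact Finset.sum_congr rfl fun b _ => Finset.sum_congr rfl fun d _ => by rw [mul_comm]
    have hs : ∑ c : Idx, (x q c ⊗ₜ[ℂ] 1) * pairing q n * (1 ⊗ₜ[ℂ] p q c) * (1 ⊗ₜ[ℂ] p q a) =
        pairing q (n + 1) * (1 ⊗ₜ[ℂ] p q a) := by rw [pairing, Finset.sum_mul]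
    -- The recursion of the q-integers, [n + 2] = 1 + q²[n + 1].
    have hq2 : ∑ k ∈ Finset.range (n + 1 + 1), (q ^ 2) ^ k =
        1 + ∑ k ∈ Finset.range (n + 1), (q ^ 2) ^ k * q ^ 2 := by
      rw [Finset.sum_range_succ', add_comm, pow_zero]
      simp only [pow_succ]
    rw [hstep, Finset.sum_congr rfl fun c _ => hc c, ← Finset.smul_sum, hs, hq2,
      Complex.ofReal_add, add_smul, Complex.ofReal_one, one_smul]

/-! ### Covariance -/

section TensorProductCoaction

variable (A B L : Type*) [Semiring A] [Algebra ℂ A] [Semiring B] [Algebra ℂ B] [Semiring L]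
  [Algebra ℂ L]

/-- The product of the second tensor factors, `(a ⊗ s) ⊗ (b ⊗ s') ↦ (a ⊗ b) ⊗ s s'`. -/
noncomputable def mulSnd : (A ⊗[ℂ] L) ⊗[ℂ] (B ⊗[ℂ] L) →ₗ[ℂ] (A ⊗[ℂ] B) ⊗[ℂ] L :=
  (LinearMap.mul' ℂ L).lTensor (A ⊗[ℂ] B) ∘ₗ
    (TensorProduct.tensorTensorTensorComm ℂ A L B L).toLinearMap

variable {A B L}

/-- The map `t ↦ (a ⊗ 1) t (1 ⊗ b)`. -/
noncomputable def mulBoth (a : A) (b : B) : A ⊗[ℂ] B →ₗ[ℂ] A ⊗[ℂ] B :=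
  TensorProduct.map (LinearMap.mulLeft ℂ a) (LinearMap.mulRight ℂ b)

theorem mulBoth_apply (a : A) (b : B) (t : A ⊗[ℂ] B) :
    mulBoth a b t = (a ⊗ₜ[ℂ] 1) * t * (1 ⊗ₜ[ℂ] b) := by
  induction t with
  | zero => simp
  | add s t hs ht => simp only [mul_add, add_mul, map_add, hs, ht]
  | tmul m f =>
    simp only [mulBoth, TensorProduct.map_tmul, LinearMap.mulLeft_apply,
      LinearMap.mulRight_apply, Algebra.TensorProduct.tmul_mul_tmul, one_mul, mul_one]

/-- As L need not be commutative, it matters that the outer factors contribute l and l' on the two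
outer sides of the inner coefficient. -/
theorem mulSnd_mul (a : A) (b : B) (l l' : L) (X : A ⊗[ℂ] L) (Y : B ⊗[ℂ] L) :
    mulSnd A B L ((a ⊗ₜ[ℂ] l * X) ⊗ₜ[ℂ] (Y * b ⊗ₜ[ℂ] l')) =
      TensorProduct.map (mulBoth a b) (LinearMap.mulLeft ℂ l ∘ₗ LinearMap.mulRight ℂ l')
        (mulSnd A B L (X ⊗ₜ[ℂ] Y)) := by
  induction X with
  | zero => simp
  | add X X' hX hX' => simp only [mul_add, TensorProduct.add_tmul, map_add, hX, hX']
  | tmul m s =>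
    induction Y with
    | zero => simp
    | add Y Y' hY hY' => simp only [add_mul, TensorProduct.tmul_add, map_add, hY, hY']
    | tmul f s' =>
      simp only [mulSnd, mulBoth, LinearMap.comp_apply, LinearEquiv.coe_coe,
        Algebra.TensorProduct.tmul_mul_tmul, TensorProduct.tensorTensorTensorComm_tmul,
        LinearMap.lTensor_tmul, LinearMap.mul'_apply, TensorProduct.map_tmul,
        LinearMap.mulLeft_apply, LinearMap.mulRight_apply, mul_assoc]

end TensorProductCoaction

theorem coactMP_tmul (m : Mq q) (f : P0 q) :
    coactMP q (m ⊗ₜ[ℂ] f) = mulSnd (Mq q) (P0 q) (LqExt q) (coactM q m ⊗ₜ[ℂ] coactP q f) := rfl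

theorem coactMP_mulBoth (hq : 0 < q) (a b : Idx) (t : Mq q ⊗[ℂ] P0 q) :
    coactMP q (mulBoth (x q a) (p q b) t) = ∑ c : Idx, ∑ d : Idx,
      TensorProduct.map (mulBoth (x q c) (p q d)) (LinearMap.mulLeft ℂ (lamExt q 1 c a) ∘ₗ
        LinearMap.mulRight ℂ (antipode q (lamExt q (-1)) b d)) (coactMP q t) := by
  induction t with
  | zero => simp
  | add s t hs ht => simp only [map_add, hs, ht, Finset.sum_add_distrib]
  | tmul m f =>
    simp only [coactMP_tmul, mulBoth, TensorProduct.map_tmul, LinearMap.mulLeft_apply,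
      LinearMap.mulRight_apply, coactM_x_mul hq.ne', coactP_mul_p hq, Finset.sum_mul,
      Finset.mul_sum, TensorProduct.sum_tmul, TensorProduct.tmul_sum, map_sum]
    rw [Finset.sum_comm]
    exact Finset.sum_congr rfl fun c _ => Finset.sum_congr rfl fun d _ => mulSnd_mul _ _ _ _ _ _

theorem sum_lamExt_antipode (hq : 0 < q) (c d : Idx) :
    ∑ a, lamExt q 1 c a * antipode q (lamExt q (-1)) a d = if c = d then 1 else 0 := by
  -- The central dilaton of the coordinate cancels its inverse from the momentum.
  have h1 : ∀ z w : LqExt q, z * LaurentPolynomial.T 1 * (w * LaurentPolynomial.T (-1)) =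
      z * w := fun z w => by
    rw [mul_assoc, ← mul_assoc _ w, (commute_T 1 w).eq, mul_assoc w, ← LaurentPolynomial.T_add,
      add_neg_cancel, LaurentPolynomial.T_zero, mul_one]
  have h2 := congrArg (constAlg q) (sum_mul_antipode_self hq (isMetric_lam q) c d)
  simp only [map_sum, map_mul, apply_ite (constAlg q), map_one, map_zero] at h2
  simp only [antipode_lamExt, lamExt, h1, ← constAlg_apply]
  exact h2

/-- By induction the inner layers contribute the coefficient 1. Only then do λ^c_a and Sλ^a_d of the
outer layer become adjacent and cancel. -/
theorem coactMP_pairing (hq : 0 < q) (n : ℕ) :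
    coactMP q (pairing q n) = pairing q n ⊗ₜ[ℂ] (1 : LqExt q) := by
  induction n with
  | zero =>
    simp only [pairing, coactMP, LinearMap.comp_apply, LinearEquiv.coe_coe,
      Algebra.TensorProduct.one_def, TensorProduct.map_tmul, coactM_one hq.ne', coactP_one hq,
      TensorProduct.tensorTensorTensorComm_tmul, LinearMap.lTensor_tmul, LinearMap.mul'_apply,
      mul_one]
  | succ n ih =>
    simp only [pairing, ← mulBoth_apply, map_sum, coactMP_mulBoth hq, ih,
      TensorProduct.map_tmul, LinearMap.comp_apply, LinearMap.mulLeft_apply,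
      LinearMap.mulRight_apply, one_mul, TensorProduct.sum_tmul]
    rw [Finset.sum_comm]
    refine Finset.sum_congr rfl fun c _ => ?_
    rw [Finset.sum_comm]
    simp only [← TensorProduct.tmul_sum, sum_lamExt_antipode hq]
    simp only [TensorProduct.tmul_ite, Finset.sum_ite_eq, Finset.mem_univ, if_true]

/-! ### The star operation -/

theorem conj_mul (hq : 0 < q) (b : Idx) (t : Mq q ⊗[ℂ] P0 q) :
    TensorProduct.map (conjM q) (conjP q) ((x q b ⊗ₜ[ℂ] 1) * t * (1 ⊗ₜ[ℂ] p q b)) =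
      (1 ⊗ₜ[ℂ] p q (bar b)) * TensorProduct.map (conjM q) (conjP q) t *
        (x q (bar b) ⊗ₜ[ℂ] 1) := by
  induction t with
  | zero => simp
  | add s t hs ht => simp only [mul_add, add_mul, map_add, hs, ht]
  | tmul m f =>
    simp only [Algebra.TensorProduct.tmul_mul_tmul, one_mul, mul_one, TensorProduct.map_tmul,
      conjM_mul hq.ne', conjP_mul hq, conjM_x hq.ne', conjP_p hq]

/-- Coordinates commute with momenta, so the innermost index pair can be pulled out in the same way
as the outermost. The star exchanges the two descriptions. -/
theorem pairing_succ' (n : ℕ) : pairing q (n + 1) =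
    ∑ b : Idx, (1 ⊗ₜ[ℂ] p q b) * pairing q n * (x q b ⊗ₜ[ℂ] 1) := by
  induction n with
  | zero => simp [pairing, Algebra.TensorProduct.one_def]
  | succ n ih =>
    have h : ∀ b c (t : Mq q ⊗[ℂ] P0 q), (x q b ⊗ₜ[ℂ] 1) *
        ((1 ⊗ₜ[ℂ] p q c) * t * (x q c ⊗ₜ[ℂ] 1)) * (1 ⊗ₜ[ℂ] p q b) =
        (1 ⊗ₜ[ℂ] p q c) * ((x q b ⊗ₜ[ℂ] 1) * t * (1 ⊗ₜ[ℂ] p q b)) * (x q c ⊗ₜ[ℂ] 1) := by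
      intro b c t
      have h1 := (commute_tmul (x q b) (p q c)).eq
      have h2 := (commute_tmul (x q c) (p q b)).eq
      simp only [mul_assoc] at h1 h2 ⊢
      rw [h2, ← mul_assoc, h1, mul_assoc]
    rw [pairing, ih]
    simp only [Finset.mul_sum, Finset.sum_mul, h]
    rw [Finset.sum_comm]
    simp only [← Finset.mul_sum, ← Finset.sum_mul, ← ih]
    rfl

theorem conj_pairing (hq : 0 < q) (n : ℕ) :
    TensorProduct.map (conjM q) (conjP q) (pairing q n) = pairing q n := by
  induction n with
  | zero =>
    simp only [pairing, Algebra.TensorProduct.one_def, TensorProduct.map_tmul, conjM_one hq.ne',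
      conjP_one hq]
  | succ n ih =>
    conv_rhs => rw [pairing_succ']
    simp only [pairing, map_sum, conj_mul hq, ih]
    exact (Equiv.mk bar bar bar_bar bar_bar).sum_comp
      fun b => (1 ⊗ₜ[ℂ] p q b) * pairing q n * (x q b ⊗ₜ[ℂ] 1)

end QMinkowski

/-! ### The q-d'Alembert equation and the plane waves -/

namespace QMinkowski

variable {q : ℝ}

/-! ### Derivatives of the exponentials -/

theorem qFactorial_succ (t : ℝ) (n : ℕ) :
    qFactorial t (n + 1) = qFactorial t n * ∑ k ∈ Finset.range (n + 1), t ^ k :=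
  Finset.prod_range_succ _ _

theorem sum_pow_pos {t : ℝ} (ht : 0 < t) (n : ℕ) : 0 < ∑ k ∈ Finset.range (n + 1), t ^ k :=
  Finset.sum_pos (fun k _ => pow_pos ht k) ⟨0, by simp⟩

theorem partialUp_qExp (hq : 0 < q) (z : ℂ) (a : Idx) :
    partialUp q a (qExp q (q ^ 2) z) = z • mulMomentum q (qExp q (q ^ 2) z) a := by
  funext n
  rw [partialUp, qExp_eq, map_smul, Pi.smul_apply]
  cases n with
  | zero => rw [partialM_pairing_zero hq.ne', smul_zero, mulMomentum, smul_zero]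
  | succ n =>
    have h : ((∑ k ∈ Finset.range (n + 1), (q ^ 2) ^ k : ℝ) : ℂ) ≠ 0 :=
      Complex.ofReal_ne_zero.2 (sum_pow_pos (pow_pos hq 2) n).ne'
    rw [partialM_pairing_succ hq, mulMomentum, qExp_eq, map_smul, lTensor_mulRight, smul_smul,
      smul_smul, qFactorial_succ, Complex.ofReal_mul, pow_succ]
    congr 1
    field_simp

/-- Two derivatives leave a scalar times the pairing followed by p^a p^b, and the cone relation
kills the contraction degree by degree. Arbitrary coefficients are allowed, which is why the base of
the q-factorial is free. -/
theorem partialUp_partialUp (hq : 0 < q) (c : ℕ → ℂ) :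
    ∑ a : Idx, ∑ b : Idx, (metricDown q a b : ℂ) •
      partialUp q a (partialUp q b fun n => c n • pairing q n) = 0 := by
  funext n
  simp only [Finset.sum_apply, Pi.smul_apply, partialUp, map_smul]
  cases n with
  | zero => simp [partialM_pairing_zero hq.ne']
  | succ n =>
    cases n with
    | zero => simp [partialM_pairing_succ hq, rTensor_mul_p, partialM_pairing_zero hq.ne']
    | succ n =>
      have h : ∑ a : Idx, ∑ b : Idx, (metricDown q a b : ℂ) •
          (pairing q n * (1 ⊗ₜ[ℂ] p q a) * (1 ⊗ₜ[ℂ] p q b)) = 0 := by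
        have h' := congrArg (fun t => pairing q n * ((1 : Mq q) ⊗ₜ[ℂ] t)) (cone_p q)
        simp only [TensorProduct.tmul_sum, TensorProduct.tmul_smul, Finset.mul_sum, mul_smul_comm,
          TensorProduct.tmul_zero, mul_zero] at h'
        simpa only [mul_assoc, Algebra.TensorProduct.tmul_mul_tmul, one_mul] using h'
      simp only [partialM_pairing_succ hq, map_smul, rTensor_mul_p, smul_mul_assoc, smul_smul]
      have h2 : ∀ a b, (metricDown q a b : ℂ) * (c (n + 1 + 1) *
          ((∑ k ∈ Finset.range (n + 1 + 1), (q ^ 2) ^ k : ℝ) : ℂ) *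
          ((∑ k ∈ Finset.range (n + 1), (q ^ 2) ^ k : ℝ) : ℂ)) =
          (c (n + 1 + 1) * ((∑ k ∈ Finset.range (n + 1 + 1), (q ^ 2) ^ k : ℝ) : ℂ) *
          ((∑ k ∈ Finset.range (n + 1), (q ^ 2) ^ k : ℝ) : ℂ)) * (metricDown q a b : ℂ) :=
        fun a b => mul_comm _ _
      simp only [← mul_assoc] at h2 ⊢
      simp only [h2, mul_smul _ (metricDown q _ _ : ℂ), ← Finset.smul_sum]
      simp only [h, smul_zero, Pi.zero_apply]

/-! ### The Laplace-Beltrami operator on functions -/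

variable (q) in
/-- The derivative `∂^a` on series, as a linear map. -/
noncomputable def partialUpLin (a : Idx) : Module.End ℂ (Series q) where
  toFun := partialUp q a
  map_add' S T := funext fun n => ((partialM q a).rTensor (P0 q)).map_add (S n) (T n)
  map_smul' c S := funext fun n => ((partialM q a).rTensor (P0 q)).map_smul c (S n)

variable (q) in
/-- The derivative `∂_a` on series, as a linear map. -/
noncomputable def partialDownLin (a : Idx) : Module.End ℂ (Series q) :=
  ∑ b : Idx, (metricDown q a b : ℂ) • partialUpLin q b

theorem partialDown_eq (a : Idx) (S : Series q) : partialDown q a S = partialDownLin q a S := by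
  simp only [partialDown, partialDownLin, LinearMap.sum_apply, LinearMap.smul_apply]
  rfl

/-- The metric need not be symmetric: here indices are lowered through the second slot of g_{ab}, as
for ∂_a, whereas `sum_metricUp_lower` uses the first. Applied to the derivatives it relates the
operator coming from the forms to g_{ab}∂^a∂^b. -/
theorem sum_metricUp_lowerLeft {E : Type*} [Semiring E] [Algebra ℂ E] (hq : 0 < q)
    (y : Idx → E) :
    ∑ c : Idx, ∑ e : Idx, (metricUp q c e : ℂ) •
      ((∑ a : Idx, (metricDown q c a : ℂ) • y a) * ∑ b : Idx, (metricDown q e b : ℂ) • y b) =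
      ∑ a : Idx, ∑ b : Idx, (metricDown q a b : ℂ) • (y a * y b) := by
  have h0 : ∀ e, ∑ c : Idx, (metricUp q c e : ℂ) • (∑ a : Idx, (metricDown q c a : ℂ) • y a) =
      y e := fun e => by
    simp only [Finset.smul_sum, smul_smul, ← Complex.ofReal_mul]
    rw [Finset.sum_comm]
    simp only [← Finset.sum_smul, ← Complex.ofReal_sum, mul_comm (metricUp q _ _),
      metricDown_transpose_mul hq]
    simp [apply_ite Complex.ofReal, ite_smul]
  have h : ∀ e, ∑ c : Idx, (metricUp q c e : ℂ) • ((∑ a : Idx, (metricDown q c a : ℂ) • y a) *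
      ∑ b : Idx, (metricDown q e b : ℂ) • y b) = y e * ∑ b : Idx, (metricDown q e b : ℂ) • y b :=
    fun e => by
      conv_rhs => rw [← h0 e, Finset.sum_mul]
      exact Finset.sum_congr rfl fun e _ => (smul_mul_assoc _ _ _).symm
  rw [Finset.sum_comm, Finset.sum_congr rfl fun c _ => h c]
  simp only [Finset.mul_sum, mul_smul_comm]

/-- The forms of valence one. -/
def oneForm (q : ℝ) (W : Idx → Series q) : Form q
  | 0, _ => 0
  | 1, a => W (a 0)
  | _ + 2, _ => 0

theorem extDeriv_zeroForm (hq : 0 < q) (S : Series q) :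
    extDeriv q (zeroForm q S) = oneForm q fun a => partialDownLin q a S := by
  funext n a
  match n with
  | 0 => rfl
  | 1 =>
    simp only [extDeriv, oneForm, sum_fin_succ_fun, antisym_one hq, partialDown_eq, zeroForm]
    simp [apply_ite Complex.ofReal, ite_smul]
  | k + 2 => simp [extDeriv, oneForm, zeroForm, partialDown_eq]

theorem extDeriv_zero : extDeriv q 0 = 0 := by
  funext n a
  cases n <;> simp [extDeriv, partialDown_eq]

theorem hodge_zero : hodge q 0 = 0 := by
  funext n a
  simp [hodge]

/-- The dual of a function is concentrated in valence 4, and the antisymmetriser of five indices is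
zero; hence the term dδ drops out on functions. -/
theorem extDeriv_hodge_zeroForm (S : Series q) : extDeriv q (hodge q (zeroForm q S)) = 0 := by
  have h : ∀ r ≠ 4, ∀ a, hodge q (zeroForm q S) r a = 0 := by
    intro r hr a
    have h0 : r ≤ 4 → ∀ u, zeroForm q S (4 - r) u = 0 := by
      intro hr' u
      obtain ⟨k, hk⟩ := Nat.exists_eq_succ_of_ne_zero (show 4 - r ≠ 0 by omega)
      revert u
      rw [hk]
      exact fun _ => rfl
    rw [hodge]
    split_ifs with h1
    · simp only [h0 h1, smul_zero, Finset.sum_const_zero]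
    · rfl
  funext n a
  cases n with
  | zero => rfl
  | succ k =>
    by_cases hk : k = 4
    · subst hk
      simp [extDeriv, antisym]
    · simp [extDeriv, h k hk, partialDown_eq]

theorem hodge_oneForm (hq : 0 < q) (W : Idx → Series q) (a : Fin 3 → Idx) :
    hodge q (oneForm q W) 3 a = ∑ e : Idx, ∑ c : Idx, (((√(normFactor q 1))⁻¹ *
      epsDown q [a 0, a 1, a 2, e] * rawMetric q e c : ℝ) : ℂ) • W c := by
  rw [hodge, if_pos (by norm_num)]
  change ∑ b : Fin 1 → Idx, ∑ c : Fin 1 → Idx, ∑ u : Fin 1 → Idx, (((√(normFactor q 1))⁻¹ *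
    epsDown q (List.ofFn a ++ List.ofFn b) * (∏ i, rawMetric q (b i) (c (Fin.rev i))) *
      antisym q 1 u c : ℝ) : ℂ) • W (u 0) = _
  simp only [sum_fin_succ_fun, antisym_one hq]
  simp [apply_ite Complex.ofReal, ite_smul, List.ofFn_succ]

theorem hodge_oneForm_of_ne (W : Idx → Series q) {r : ℕ} (hr : r ≠ 3) (a : Fin r → Idx) :
    hodge q (oneForm q W) r a = 0 := by
  have h0 : r ≤ 4 → ∀ u, oneForm q W (4 - r) u = 0 := by
    intro hr'
    have : 4 - r ≠ 1 := by omega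
    generalize 4 - r = k at this
    match k with
    | 0 => exact fun _ => rfl
    | 1 => exact absurd rfl this
    | k + 2 => exact fun _ => rfl
  rw [hodge]
  split_ifs with h1
  · simp only [h0 h1, smul_zero, Finset.sum_const_zero]
  · rfl

theorem sum_epsUp_smul_epsDown (hq : 0 < q) {N : Type*} [AddCommGroup N] [Module ℂ N]
    (V : Idx → N) (a : Idx) :
    ∑ b : Idx, ∑ c : Idx, ∑ d : Idx, (epsUp q [d, c, b, a] : ℂ) •
      ∑ e : Idx, (epsDown q [b, c, d, e] : ℂ) • V e = -(normFactor q 1 : ℂ) • V a := by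
  simp only [Finset.smul_sum, smul_smul, ← Complex.ofReal_mul]
  have h := Finset.sum_comm (s := (Finset.univ : Finset (Idx × Idx × Idx)))
    (t := (Finset.univ : Finset Idx)) (f := fun i e => ((epsUp q [i.2.2, i.2.1, i.1, a] *
      epsDown q [i.1, i.2.1, i.2.2, e] : ℝ) : ℂ) • V e)
  simp only [Fintype.sum_prod_type] at h
  rw [h]
  simp only [← Finset.sum_smul, ← Complex.ofReal_sum, sum_epsUp_mul_epsDown hq]
  simp [apply_ite Complex.ofReal, ite_smul]

theorem antisym_four (b u : Fin 4 → Idx) : antisym q 4 b u =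
    (normFactor q 4)⁻¹ * epsDown q (List.ofFn u) * epsUp q [b 3, b 2, b 1, b 0] := by
  have h : ∑ s : Fin (4 - 4) → Idx,
      epsUp q (List.ofFn b ++ List.ofFn s).reverse * epsDown q (List.ofFn s ++ List.ofFn u) =
      epsUp q [b 3, b 2, b 1, b 0] * epsDown q (List.ofFn u) := by
    change ∑ s : Fin 0 → Idx, epsUp q (List.ofFn b ++ List.ofFn s).reverse *
      epsDown q (List.ofFn s ++ List.ofFn u) = _
    rw [Fintype.sum_unique]
    simp [List.ofFn_succ]
  rw [antisym, if_neg (by norm_num), if_pos (by norm_num), h]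
  ring

/-- The upper tensor comes from the antisymmetriser in d and the lower one from the Hodge star;
their contraction is -n₁ times the identity, so only the metric contraction survives. -/
theorem sum_epsUp_smul_map (hq : 0 < q) {N : Type*} [AddCommGroup N] [Module ℂ N]
    (D : N →ₗ[ℂ] N) (W : Idx → N) (K L : ℝ) (a : Idx) :
    ∑ b : Idx, ∑ c : Idx, ∑ d : Idx, ((K * epsUp q [d, c, b, a] : ℝ) : ℂ) •
      D (∑ e : Idx, ∑ g : Idx, ((L * epsDown q [b, c, d, e] * rawMetric q e g : ℝ) : ℂ) • W g) =
    ((K * L * (q + q⁻¹) * -normFactor q 1 : ℝ) : ℂ) •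
      ∑ g : Idx, (metricUp q a g : ℂ) • D (W g) := by
  have h := sum_epsUp_smul_epsDown hq (fun e => ∑ g : Idx, (metricUp q e g : ℂ) • D (W g)) a
  have hG : ∀ e g, rawMetric q e g = (q + q⁻¹) * metricUp q e g := fun e g => by
    have : q + q⁻¹ ≠ 0 := by positivity
    rw [metricUp]
    field_simp
  have h' : ∀ b c d, ((K * epsUp q [d, c, b, a] : ℝ) : ℂ) •
      D (∑ e : Idx, ∑ g : Idx, ((L * epsDown q [b, c, d, e] * rawMetric q e g : ℝ) : ℂ) • W g) =
      ((K * L * (q + q⁻¹) : ℝ) : ℂ) • (epsUp q [d, c, b, a] : ℂ) •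
        ∑ e : Idx, (epsDown q [b, c, d, e] : ℂ) • ∑ g : Idx, (metricUp q e g : ℂ) • D (W g) := by
    intro b c d
    simp only [map_sum, map_smul, Finset.smul_sum, smul_smul, hG]
    refine Finset.sum_congr rfl fun e _ => Finset.sum_congr rfl fun g _ => ?_
    congr 1
    push_cast
    ring
  simp only [h', ← Finset.smul_sum]
  rw [h, smul_smul]
  push_cast
  rfl

/-- The dual of a 1-form is a 3-form, and its differential is the antisymmetric tensor times a
multiple of the divergence g^{ac}∂_a W_c. -/
theorem coderiv_oneForm (hq : 0 < q) (W : Idx → Series q)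
    (hW : ∑ a : Idx, ∑ c : Idx, (metricUp q a c : ℂ) • partialDownLin q a (W c) = 0) :
    coderiv q (oneForm q W) = 0 := by
  have h4 : ∀ k, ∀ u, extDeriv q (hodge q (oneForm q W)) k u = 0 := by
    intro k u
    cases k with
    | zero => rfl
    | succ k =>
      by_cases hk : k = 3
      · subst hk
        change ∑ b : Fin 4 → Idx, (antisym q 4 b u : ℂ) •
          partialDown q (b 0) (hodge q (oneForm q W) 3 (Fin.tail b)) = 0
        simp only [partialDown_eq, antisym_four, hodge_oneForm hq, sum_fin_succ_fun,
          Fintype.sum_unique]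
        change ∑ a : Idx, ∑ b : Idx, ∑ c : Idx, ∑ d : Idx,
          (((normFactor q 4)⁻¹ * epsDown q (List.ofFn u) * epsUp q [d, c, b, a] : ℝ) : ℂ) •
          partialDownLin q a (∑ e : Idx, ∑ g : Idx, (((√(normFactor q 1))⁻¹ *
            epsDown q [b, c, d, e] * rawMetric q e g : ℝ) : ℂ) • W g) = 0
        refine (Finset.sum_congr rfl fun a _ =>
          sum_epsUp_smul_map hq (partialDownLin q a) W _ _ a).trans ?_
        rw [← Finset.smul_sum, hW, smul_zero]
      · simp [extDeriv, hodge_oneForm_of_ne W hk, partialDown_eq]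
  have h5 : extDeriv q (hodge q (oneForm q W)) = 0 := funext fun k => funext fun u => h4 k u
  rw [coderiv, h5, hodge_zero]

theorem laplaceBeltrami_zeroForm (hq : 0 < q) (S : Series q)
    (hS : ∑ a : Idx, ∑ b : Idx, (metricDown q a b : ℂ) • partialUp q a (partialUp q b S) = 0) :
    laplaceBeltrami q (zeroForm q S) = 0 := by
  have h := LinearMap.congr_fun (sum_metricUp_lowerLeft hq (partialUpLin q)) S
  simp only [LinearMap.sum_apply, LinearMap.smul_apply, Module.End.mul_apply] at h
  have hW : ∑ a : Idx, ∑ c : Idx, (metricUp q a c : ℂ) •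
      partialDownLin q a (partialDownLin q c S) = 0 := by
    simp only [partialDownLin, LinearMap.sum_apply, LinearMap.smul_apply]
    exact h.trans hS
  rw [laplaceBeltrami, extDeriv_zeroForm hq, coderiv_oneForm hq _ hW, coderiv,
    extDeriv_hodge_zeroForm, hodge_zero, extDeriv_zero, add_zero]

/-! ### The plane waves -/

theorem planeWave_apply (t : ℝ) (v : ℂ × ℂ) (n : ℕ) : planeWave q t v n =
    ((v.1 * Complex.I ^ n + v.2 * (-Complex.I) ^ n) / (qFactorial t n : ℂ)) • pairing q n := by
  change (v.1 • qExp q t Complex.I + v.2 • qExp q t (-Complex.I)) n = _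
  rw [Pi.add_apply, Pi.smul_apply, Pi.smul_apply, qExp_eq, qExp_eq, smul_smul, smul_smul,
    ← add_smul]
  congr 1
  ring

theorem isComplexSolution_planeWave (hq : 0 < q) (t : ℝ) :
    IsComplexSolution q (planeWave q t) where
  star_map v := by
    funext n
    rw [conjSeries, planeWave_apply, planeWave_apply, LinearMap.map_smulₛₗ, conj_pairing hq]
    congr 1
    -- The star swaps the two coefficients and conjugation swaps i with -i; the q-factorial is real.
    simp only [conjPair, map_div₀, map_add, map_mul, map_pow, map_neg, Complex.conj_I,
      Complex.conj_ofReal, neg_neg]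
    rw [add_comm]
  covariant v n := by
    rw [planeWave_apply, map_smul, coactMP_pairing hq, TensorProduct.smul_tmul']
  dalembert v := by
    refine laplaceBeltrami_zeroForm hq _ ?_
    have h : planeWave q t v = fun n => ((v.1 * Complex.I ^ n + v.2 * (-Complex.I) ^ n) /
        (qFactorial t n : ℂ)) • pairing q n := funext fun n => planeWave_apply t v n
    rw [h]
    exact partialUp_partialUp hq _

end QMinkowski

theorem mainTheorem9 (q : ℝ) (hq : 0 < q) :
    QMinkowski.WellDefined q ∧
    (∀ t : ℝ, 0 < t → QMinkowski.IsComplexSolution q (QMinkowski.planeWave q t)) ∧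
    (∀ (z : ℂ) (a : QMinkowski.Idx),
      QMinkowski.partialUp q a (QMinkowski.qExp q (q ^ 2) z) =
        z • QMinkowski.mulMomentum q (QMinkowski.qExp q (q ^ 2) z) a) :=
  ⟨QMinkowski.wellDefined hq, fun t _ => QMinkowski.isComplexSolution_planeWave hq t,
    fun z a => QMinkowski.partialUp_qExp hq z a⟩
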